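/- Let $(\Omega,\rho_\Omega)$ be a complete separable metric space with its Borel $\sigma$-algebra, $\mu$ a Borel probability measure on $\Omega$, $t_0<T$, $\mathbb B$ the open unit ball of $\mathbb R^n$, and $L^2:=L^2(\mu,\Omega;\mathbb R^n)$ with its scalar product $\langle\cdot,\cdot\rangle$. Let $f_0,\dots,f_m:\mathbb R^n\times\Omega\to\mathbb R^n$ (with $f_i(x,\cdot)$ measurable), $g:\mathbb R^n\times\Omega\to\mathbb R$, $\varphi\in L^2$, and let $U(t)\subset\mathbb R^m$, $t\in[t_0,T]$, be non-empty closed sets contained in a common compact set. Put $f(x,u,\omega)=f_0(x,\omega)+\sum_{i=1}^m u_i f_i(x,\omega)$, and for $\psi\in L^2$, $u\in\mathbb R^m$ let $f(\psi,u):=f(\psi(\cdot),u,\cdot)\in L^2$. An admissible process is a pair $(x,u)$ with $u\in L^\infty(t_0,T;\mathbb R^m)$, $u(t)\in U(t)$ for a.e. $t$, and, for every $\omega\in\Omega$, $x(\cdot,\omega)\in W^{1,1}([t_0,T];\mathbb R^n)$ with $x(t,\omega)=\varphi(\omega)+\int_{t_0}^t f(x(s,\omega),u(s),\omega)\,ds$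 on $[t_0,T]$; we write $x(t)=x(t,\cdot)\in L^2$. An admissible process $(\bar x,\bar u)$ is a $W^{1,1}$-local minimizer if there is $\epsilon>0$ such that $\int_\Omega g(\bar x(T,\omega),\omega)\,d\mu\le\int_\Omega g(x(T,\omega),\omega)\,d\mu$ for all admissible processes $(x,u)$ with $\|\bar x-x\|_{W^{1,1}([t_0,T];L^2)}\le\epsilon$, where $\|y\|_{W^{1,1}}=\|y\|_1+\|\dot y\|_1$. Assume (H0): $U(t)$ is convex for a.e. $t$ and the graph of $U$ is $\mathcal L\times\mathcal B^m$-measurable; for each $i$ there are $c_i,k_i>0$ with $|f_i(x,\omega)|\le c_i(1+|x|)$ and $|f_i(x,\omega)-f_i(x',\omega)|\le k_i|x-x'|$ for all $x,x',\omega$; $g$ is Borel measurable, bounded, and Lipschitz in $x$ uniformly in $\omega$. Let $(\bar x,\bar u)$ be a $W^{1,1}$-local minimizer and assume (H1): for some $\delta>0$, (i) there is a modulus of continuity $\theta_f$ (non-decreasing $[0,\infty)\to[0,\infty)$ with limit $0$ at $0^+$) such that $\int_{t_0}^T\sup_{x\in\bar x(t,\omega)+\delta\mathbb B,\,u\in U(t)}|f(x,u,\omega_1)-f(x,u,\omega_2)|\,dt\le\theta_f(\rho_\Omega(\omega_1,\omega_2))$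 for all $\omega,\omega_1,\omega_2$; (ii) for every $\omega$, $g(\cdot,\omega)$ is differentiable with continuous gradient on $\bar x(T,\omega)+\delta\mathbb B$; for every $x$, $\nabla_xg(x,\cdot)$ is continuous on $\{\omega: x\in\bar x(T,\omega)+\delta\mathbb B\}$; and $\sup_\omega|\nabla_xg(\bar x(T,\omega),\omega)|<\infty$; (iii) for every $\omega$, a.e. $t$ and all $u\in U(t)$, $f(\cdot,u,\omega)$ is $C^1$ on $\bar x(t,\omega)+\delta\mathbb B$; and $\omega\mapsto\nabla_xf(x,u,\omega)$ is continuous, uniformly in $(t,x,u)$ with $u\in U(t)$ and $x$ in these balls; (iv) for every $i$ and $\omega$ and a.e. $t$, $f_i(\cdot,\omega)$ is $C^2$ on $\bar x(t,\omega)+\delta\mathbb B$, and its first and second derivatives at $\bar x(t,\omega)$ are bounded by a constant for $\omega\in\operatorname{supp}\mu$ and a.e. $t$. Let $A(t)=\frac{\partial f}{\partial x}(\bar x(t),\bar u(t))$ be the bounded operator $\psi\mapsto\nabla_xf(\bar x(t,\cdot),\bar u(t),\cdot)\,\psi(\cdot)$ on $L^2$, and $q:=\nabla_xg(\bar x(T,\cdot),\cdot)\in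 L^2$. Then the linearized system has an evolution operator $G(s,t)$, $t_0\le t\le s\le T$, that is, $G(t,t)=I$ and $\partial_sG(s,t)=A(s)G(s,t)$ (in the strong sense: $G(s,t)\psi=\psi+\int_t^sA(r)G(r,t)\psi\,dr$ for all $\psi\in L^2$), and the function $p(t):=-G^*(T,t)q$ belongs to $W^{1,1}([t_0,T];L^2)$, is the unique solution in this space of the backward problem $$-\dot p(t)=A(t)^*p(t)\ \text{ for a.e. } t\in[t_0,T],\qquad -p(T)=q,$$ and satisfies $$\langle p(t),f(\bar x(t),\bar u(t))\rangle=\max_{u\in U(t)}\langle p(t),f(\bar x(t),u)\rangle\quad\text{for a.e. }t\in[t_0,T].$$ -/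

import Mathlib

open MeasureTheory Set Filter Topology
open scoped ENNReal

namespace EnsemblePMP

noncomputable section

/-- `ℝⁿ` with its Euclidean norm. -/
abbrev Vec (n : ℕ) : Type := EuclideanSpace ℝ (Fin n)

/-- `x` is (the continuous representative of) an element of `W^{1,1}([a,b]; X)` and `x'` is its
derivative: `x'` is Bochner integrable on `[a,b]` and `x` is a primitive of `x'` there. -/
def HasW11Deriv {X : Type*} [NormedAddCommGroup X] [NormedSpace ℝ X]
    (a b : ℝ) (x x' : ℝ → X) : Prop :=
  IntervalIntegrable x' volume a b ∧ ∀ t ∈ Icc a b, x t = x a + ∫ s in a..t, x' s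

/-- The norm `‖x‖₁ + ‖x'‖₁` of `W^{1,1}([a,b]; X)`, for `x` with derivative `x'`. -/
def w11Norm {X : Type*} [NormedAddCommGroup X] (a b : ℝ) (x x' : ℝ → X) : ℝ :=
  (∫ t in a..b, ‖x t‖) + ∫ t in a..b, ‖x' t‖

open Classical in
/-- The class in `L^p(μ, Ω; F)` of a function `φ : Ω → F` in `𝓛^p` (and `0` otherwise). -/
def toLpClass {Ω F : Type*} [MeasurableSpace Ω] [NormedAddCommGroup F]
    (p : ℝ≥0∞) (μ : Measure Ω) (φ : Ω → F) : Lp F p μ :=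
  if h : MemLp φ p μ then h.toLp φ else 0

section Dynamics

variable {Ω : Type*} {n m : ℕ}

/-- The control-affine dynamics `f(x,u,ω) = f₀(x,ω) + ∑ᵢ uᵢ fᵢ(x,ω)`. -/
def dyn (f : Fin (m + 1) → Vec n → Ω → Vec n) (x : Vec n) (u : Vec m) (ω : Ω) : Vec n :=
  f 0 x ω + ∑ i : Fin m, u i • f i.succ x ω

/-- The Jacobian `∂f/∂x (x,u,ω)` of the dynamics. -/
def dynJac (f : Fin (m + 1) → Vec n → Ω → Vec n) (x : Vec n) (u : Vec m) (ω : Ω) :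
    Vec n →L[ℝ] Vec n :=
  fderiv ℝ (fun y => dyn f y u ω) x

/-- Admissible processes: `u ∈ L^∞` with `u(t) ∈ U(t)` a.e., and for every `ω` the arc `x(·,ω)`
is a `W^{1,1}` solution of `ẋ = f(x,u,ω)`, `x(t₀,ω) = φ(ω)`, i.e. of the integral equation. -/
structure IsAdmissible (f : Fin (m + 1) → Vec n → Ω → Vec n) (U : ℝ → Set (Vec m))
    (φ : Ω → Vec n) (t₀ T : ℝ) (u : ℝ → Vec m) (x : ℝ → Ω → Vec n) : Prop where
  control_memLp : MemLp u ∞ (volume.restrict (Icc t₀ T))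
  control_mem : ∀ᵐ t ∂volume.restrict (Icc t₀ T), u t ∈ U t
  init : ∀ ω, x t₀ ω = φ ω
  arc : ∀ ω, HasW11Deriv t₀ T (fun t => x t ω) (fun t => dyn f (x t ω) (u t) ω)

variable [MeasurableSpace Ω]

/-- The dynamics as a map into `L²(μ, Ω; ℝⁿ)`: `f(φ,u) = f(φ(·),u,·)`. -/
def dynL2 (μ : Measure Ω) (f : Fin (m + 1) → Vec n → Ω → Vec n) (φ : Ω → Vec n) (u : Vec m) :
    Lp (Vec n) 2 μ :=
  toLpClass 2 μ (fun ω => dyn f (φ ω) u ω)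

/-- The operator `∂f/∂x (φ,u)` on `L²(μ, Ω; ℝⁿ)`: the multiplication operator
`ψ ↦ (∂f/∂x (φ(·),u,·)) ψ(·)` by the (essentially bounded) Jacobian. -/
def linOp (μ : Measure Ω) (f : Fin (m + 1) → Vec n → Ω → Vec n) (φ : Ω → Vec n) (u : Vec m) :
    Lp (Vec n) 2 μ →L[ℝ] Lp (Vec n) 2 μ :=
  (ContinuousLinearMap.id ℝ (Vec n →L[ℝ] Vec n)).holderL μ ∞ 2 2
    (toLpClass ∞ μ (fun ω => dynJac f (φ ω) u ω))

/-- `W^{1,1}`-local minimizers of `J = ∫ g(x(T,ω),ω) dμ(ω)`, the state being regarded as the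
`L²(μ, Ω; ℝⁿ)`-valued arc `t ↦ x(t,·)`: the process is admissible, and its cost is minimal among
the admissible processes whose state is `ε`-close to its own in `W^{1,1}([t₀,T]; L²(μ,Ω;ℝⁿ))`. -/
def IsW11LocalMinimizer (μ : Measure Ω) (f : Fin (m + 1) → Vec n → Ω → Vec n)
    (g : Vec n → Ω → ℝ) (U : ℝ → Set (Vec m)) (φ : Ω → Vec n) (t₀ T : ℝ)
    (u : ℝ → Vec m) (x : ℝ → Ω → Vec n) : Prop :=
  IsAdmissible f U φ t₀ T u x ∧
  ∃ ε > 0, ∀ (v : ℝ → Vec m) (y : ℝ → Ω → Vec n), IsAdmissible f U φ t₀ T v y →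
    ∀ d : ℝ → Lp (Vec n) 2 μ,
      HasW11Deriv t₀ T (fun t => toLpClass 2 μ (x t) - toLpClass 2 μ (y t)) d →
      w11Norm t₀ T (fun t => toLpClass 2 μ (x t) - toLpClass 2 μ (y t)) d ≤ ε →
      ∫ ω, g (x T ω) ω ∂μ ≤ ∫ ω, g (y T ω) ω ∂μ

/-- The standing assumptions (H0). -/
structure H0 (f : Fin (m + 1) → Vec n → Ω → Vec n)
    (g : Vec n → Ω → ℝ) (U : ℝ → Set (Vec m)) (t₀ T : ℝ) : Prop where
  U_nonempty : ∀ t ∈ Icc t₀ T, (U t).Nonempty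
  U_closed : ∀ t ∈ Icc t₀ T, IsClosed (U t)
  U_bounded : ∃ K : Set (Vec m), IsCompact K ∧ ∀ t ∈ Icc t₀ T, U t ⊆ K
  U_convex : ∀ᵐ t ∂volume.restrict (Icc t₀ T), Convex ℝ (U t)
  /-- The graph of `U` is measurable for (Lebesgue σ-algebra) × (Borel σ-algebra). -/
  U_graph : MeasurableSet
    {z : NullMeasurableSpace ℝ (volume : Measure ℝ) × Vec m | z.1 ∈ Icc t₀ T ∧ z.2 ∈ U z.1}
  f_measurable : ∀ i x, Measurable (f i x)
  f_growth : ∀ i, ∃ c > 0, ∀ x ω, ‖f i x ω‖ ≤ c * (1 + ‖x‖)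
  f_lipschitz : ∀ i, ∃ k > 0, ∀ x x' ω, ‖f i x ω - f i x' ω‖ ≤ k * ‖x - x'‖
  g_measurable : Measurable (fun z : Vec n × Ω => g z.1 z.2)
  g_bounded : ∃ M > 0, ∀ x ω, |g x ω| ≤ M
  g_lipschitz : ∃ k ≥ (1 : ℝ), ∀ x x' ω, |g x ω - g x' ω| ≤ k * ‖x - x'‖

/-- The regularity assumptions (H1) along the reference arc `x`, with radius `δ`. Gradients and
Jacobians are only evaluated in the tube of radius `δ` around the reference arc. -/
structure H1 [PseudoMetricSpace Ω] (μ : Measure Ω) (f : Fin (m + 1) → Vec n → Ω → Vec n)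
    (g : Vec n → Ω → ℝ) (U : ℝ → Set (Vec m)) (t₀ T : ℝ) (x : ℝ → Ω → Vec n) (δ : ℝ) :
    Prop where
  f_modulus : ∃ θ : ℝ → ℝ, (∀ s, 0 ≤ s → 0 ≤ θ s) ∧ MonotoneOn θ (Ici 0) ∧
    Tendsto θ (𝓝[>] 0) (𝓝 0) ∧
    ∀ ω ω₁ ω₂ : Ω, ∫⁻ t in Icc t₀ T,
        (⨆ y ∈ Metric.ball (x t ω) δ, ⨆ u ∈ U t, ‖dyn f y u ω₁ - dyn f y u ω₂‖ₑ)
      ≤ ENNReal.ofReal (θ (dist ω₁ ω₂))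
  g_diff : ∀ ω, ∀ y ∈ Metric.ball (x T ω) δ, DifferentiableAt ℝ (fun z => g z ω) y
  g_grad_cont : ∀ ω, ContinuousOn (gradient (fun z => g z ω)) (Metric.ball (x T ω) δ)
  g_grad_cont_param : ∀ y, ContinuousOn (fun ω => gradient (fun z => g z ω) y)
    {ω | y ∈ Metric.ball (x T ω) δ}
  g_grad_bounded : ∃ C > 0, ∀ ω, ‖gradient (fun z => g z ω) (x T ω)‖ ≤ C
  f_contDiff : ∀ ω, ∀ᵐ t ∂volume.restrict (Icc t₀ T), ∀ u ∈ U t,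
    ContDiffOn ℝ 1 (fun y => dyn f y u ω) (Metric.ball (x t ω) δ)
  f_jac_cont_param : ∀ ω₀, ∀ η > 0, ∃ r > 0, ∀ ω, dist ω ω₀ < r →
    ∀ᵐ t ∂volume.restrict (Icc t₀ T), ∀ u ∈ U t,
      ∀ y ∈ Metric.ball (x t ω₀) δ ∩ Metric.ball (x t ω) δ,
        ‖dynJac f y u ω - dynJac f y u ω₀‖ ≤ η
  fi_contDiff : ∀ i ω, ∀ᵐ t ∂volume.restrict (Icc t₀ T),
    ContDiffOn ℝ 2 (fun y => f i y ω) (Metric.ball (x t ω) δ)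
  fi_bounded : ∀ i, ∀ k ∈ ({1, 2} : Set ℕ), ∃ C > 0, ∀ ω ∈ μ.support,
    ∀ᵐ t ∂volume.restrict (Icc t₀ T), ‖iteratedFDeriv ℝ k (fun y => f i y ω) (x t ω)‖ < C

end Dynamics

/-- `G` is the evolution operator of `ẇ = A(s) w` on `[t₀,T]`: `G(t,t) = I` and
`∂G/∂s (s,t) = A(s) G(s,t)` for `t₀ ≤ t ≤ s ≤ T`, in the strong sense (applied to each vector). -/
def IsEvolutionOperator {H : Type*} [NormedAddCommGroup H] [NormedSpace ℝ H]
    (A : ℝ → H →L[ℝ] H) (t₀ T : ℝ) (G : ℝ → ℝ → H →L[ℝ] H) : Prop :=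
  ∀ t ∈ Icc t₀ T, G t t = ContinuousLinearMap.id ℝ H ∧
    ∀ ψ : H, HasW11Deriv t T (fun s => G s t ψ) (fun s => A s (G s t ψ))

end

end EnsemblePMP

/-!
Let `w` be another bounded control with values in `U`. As `U(t)` is convex, the controls
`v + ε(w - v)` are admissible, and their trajectories are `O(ε)`-close to that of `v` in
`W^{1,1}([t₀,T]; L²)`. Minimality therefore gives `⟨q, y(T)⟩ ≥ 0` for the first variation `y`,
which solves `ẏ = A y + f(x,w) - f(x,v)`, `y(t₀) = 0`. By duality,
`d/dt ⟨p, y⟩ = ⟨p, f(x,w) - f(x,v)⟩`, and as `p(T) = -q` this yields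
`∫ ⟨p, f(x,w)⟩ dt ≤ ∫ ⟨p, f(x,v)⟩ dt` for all `w`. If the pointwise maximum condition failed on a
set of times of positive measure, a measurable selection of better control values would contradict
this inequality. Such a selection is needed only on a subset of positive measure of the projection
of a Borel set, where it comes from a compact set with a projection of positive measure.

To speak of arcs in `L²`, one needs trajectories which are jointly measurable in `(t, ω)`: the
initial state and the control are replaced by Borel representatives, and the trajectories are built
by Picard iteration, which preserves joint measurability.
-/

namespace EnsemblePMP

/-! ### Arcs of class `W^{1,1}` -/

section Arcs

variable {X : Type*} [NormedAddCommGroup X] {a b : ℝ} {w w' z z' : ℝ → X}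

theorem w11Norm_congr (hab : a ≤ b) (hz : ∀ t ∈ Icc a b, z t = w t) :
    w11Norm a b z w' = w11Norm a b w w' := by
  rw [w11Norm, w11Norm, intervalIntegral.integral_congr fun t ht => by
    rw [hz t (uIcc_of_le hab ▸ ht)]]

theorem w11Norm_le {c : ℝ} (hab : a ≤ b) (hw : ∀ t, ‖w t‖ ≤ c) (hw' : ∀ t, ‖w' t‖ ≤ c) :
    w11Norm a b w w' ≤ 2 * c * (b - a) := by
  have hle : ∀ z : ℝ → X, (∀ t, ‖z t‖ ≤ c) → ∫ t in a..b, ‖z t‖ ≤ c * (b - a) := fun z hz => by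
    rw [← abs_of_nonneg (sub_nonneg.2 hab)]
    exact (le_abs_self _).trans (intervalIntegral.norm_integral_le_of_norm_le_const
      fun t _ => (norm_norm (z t)).trans_le (hz t))
  rw [w11Norm]
  linarith [hle w hw, hle w' hw']

variable [NormedSpace ℝ X]

theorem HasW11Deriv.intervalIntegrable (h : HasW11Deriv a b w w') {s t : ℝ} (hs : s ∈ Icc a b)
    (ht : t ∈ Icc a b) : IntervalIntegrable w' volume s t :=
  h.1.mono_set (uIcc_subset_uIcc (Icc_subset_uIcc hs) (Icc_subset_uIcc ht))

theorem HasW11Deriv.sub_eq (h : HasW11Deriv a b w w') {s t : ℝ} (hs : s ∈ Icc a b)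
    (ht : t ∈ Icc a b) : w t - w s = ∫ r in s..t, w' r := by
  have ha : a ∈ Icc a b := ⟨le_rfl, hs.1.trans hs.2⟩
  rw [h.2 t ht, h.2 s hs, add_sub_add_left_eq_sub,
    intervalIntegral.integral_interval_sub_left (h.intervalIntegrable ha ht)
      (h.intervalIntegrable ha hs)]

theorem HasW11Deriv.continuousOn (h : HasW11Deriv a b w w') : ContinuousOn w (Icc a b) := by
  refine ContinuousOn.congr (continuousOn_const.add ?_) h.2
  exact (intervalIntegral.continuousOn_primitive_interval' h.1 left_mem_uIcc).mono Icc_subset_uIcc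

theorem HasW11Deriv.mono (h : HasW11Deriv a b w w') {c d : ℝ} (hc : c ∈ Icc a b)
    (hd : d ∈ Icc a b) : HasW11Deriv c d w w' :=
  ⟨h.intervalIntegrable hc hd, fun t ht => by
    rw [← h.sub_eq hc ⟨hc.1.trans ht.1, ht.2.trans hd.2⟩, add_sub_cancel]⟩

theorem HasW11Deriv.congr (h : HasW11Deriv a b w w') (hab : a ≤ b)
    (hz : ∀ t ∈ Icc a b, z t = w t)
    (hz' : ∀ᵐ t ∂volume.restrict (Icc a b), z' t = w' t) : HasW11Deriv a b z z' := by
  have hae : ∀ t ∈ Icc a b, w' =ᵐ[volume.restrict (uIoc a t)] z' := fun t ht => by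
    refine ae_mono (Measure.restrict_mono ?_ le_rfl) (hz'.mono fun _ h => h.symm)
    rw [uIoc_of_le ht.1]
    exact fun s hs => ⟨hs.1.le, hs.2.trans ht.2⟩
  refine ⟨h.1.congr_ae (hae b ⟨hab, le_rfl⟩), fun t ht => ?_⟩
  rw [hz t ht, hz a ⟨le_rfl, hab⟩, h.2 t ht,
    intervalIntegral.integral_congr_ae_restrict (hae t ht)]

theorem HasW11Deriv.sub (h : HasW11Deriv a b w w') (hz : HasW11Deriv a b z z') :
    HasW11Deriv a b (fun t => w t - z t) (fun t => w' t - z' t) := by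
  refine ⟨h.1.sub hz.1, fun t ht => ?_⟩
  have ha : a ∈ Icc a b := ⟨le_rfl, ht.1.trans ht.2⟩
  rw [intervalIntegral.integral_sub (h.intervalIntegrable ha ht) (hz.intervalIntegrable ha ht),
    ← h.sub_eq ha ht, ← hz.sub_eq ha ht]
  dsimp only
  abel

theorem HasW11Deriv.const_smul (h : HasW11Deriv a b w w') (c : ℝ) :
    HasW11Deriv a b (fun t => c • w t) (fun t => c • w' t) :=
  ⟨h.1.smul c, fun t ht => by
    rw [intervalIntegral.integral_smul, ← smul_add, ← h.2 t ht]⟩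

theorem HasW11Deriv.norm_sub_le (h : HasW11Deriv a b w w') {s t : ℝ} (hs : s ∈ Icc a b)
    (ht : t ∈ Icc a b) : ‖w t - w s‖ ≤ |∫ r in s..t, ‖w' r‖| := by
  rw [h.sub_eq hs ht]
  exact intervalIntegral.norm_integral_le_abs_integral_norm

/-! ### Grönwall's inequality -/

theorem le_mul_exp_of_le_add_mul_integral {r : ℝ → ℝ} {c K : ℝ} (hK : 0 ≤ K) (hc : 0 ≤ c)
    (hr : ContinuousOn r (Icc a b)) (hr₀ : ∀ t ∈ Icc a b, 0 ≤ r t)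
    (h : ∀ t ∈ Icc a b, r t ≤ c + K * ∫ s in a..t, r s) :
    ∀ t ∈ Icc a b, r t ≤ c * Real.exp (K * (t - a)) := by
  intro t ht
  have hab : a ≤ b := ht.1.trans ht.2
  have hri : IntervalIntegrable r volume a b := hr.intervalIntegrable_of_Icc hab
  let R : ℝ → ℝ := fun s => c + K * ∫ τ in a..s, r τ
  have hR : ∀ s ∈ Ico a b, HasDerivWithinAt R (K * r s) (Ici s) s := fun s hs => by
    have hIoc : Ioc s b ∈ 𝓝[>] s := Ioc_mem_nhdsGT hs.2
    have hsub : Ioc s b ⊆ Icc a b := fun τ hτ => ⟨hs.1.trans hτ.1.le, hτ.2⟩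
    refine HasDerivWithinAt.const_add _ (HasDerivWithinAt.const_mul _ ?_)
    exact intervalIntegral.integral_hasDerivWithinAt_right
      (hri.mono_set (uIcc_subset_uIcc left_mem_uIcc (Icc_subset_uIcc ⟨hs.1, hs.2.le⟩)))
      ⟨Ioc s b, hIoc, (hr.mono hsub).aestronglyMeasurable measurableSet_Ioc⟩
      ((hr s ⟨hs.1, hs.2.le⟩).mono_of_mem_nhdsWithin (mem_of_superset hIoc hsub))
  have hRc : ContinuousOn R (Icc a b) := by
    refine continuousOn_const.add (continuousOn_const.mul ?_)
    exact (intervalIntegral.continuousOn_primitive_interval' hri left_mem_uIcc).mono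
      Icc_subset_uIcc
  have hR₀ : ∀ s ∈ Icc a b, 0 ≤ R s := fun s hs => (hr₀ s hs).trans (h s hs)
  have hgron := norm_le_gronwallBound_of_norm_deriv_right_le (δ := c) (K := K) (ε := 0) hRc hR
    (by simp [R, abs_of_nonneg hc])
    (fun s hs => by
      have hs' : s ∈ Icc a b := ⟨hs.1, hs.2.le⟩
      rw [add_zero, Real.norm_of_nonneg (mul_nonneg hK (hr₀ s hs')),
        Real.norm_of_nonneg (hR₀ s hs')]
      exact mul_le_mul_of_nonneg_left (h s hs') hK) t ht
  rw [gronwallBound_ε0] at hgron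
  exact (h t ht).trans ((le_abs_self _).trans hgron)

theorem HasW11Deriv.norm_le_add_integral (h : HasW11Deriv a b w w') {K : ℝ} {e : ℝ → ℝ}
    (he : IntervalIntegrable e volume a b) (he₀ : ∀ t, 0 ≤ e t)
    (hw : ∀ᵐ t ∂volume.restrict (Icc a b), ‖w' t‖ ≤ K * ‖w t‖ + e t) {t : ℝ} (ht : t ∈ Icc a b) :
    ‖w t‖ ≤ (‖w a‖ + ∫ s in a..b, e s) + K * ∫ s in a..t, ‖w s‖ := by
  have hsub : Icc a t ⊆ Icc a b := Icc_subset_Icc_right ht.2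
  have hwi : IntervalIntegrable (fun s => K * ‖w s‖) volume a t :=
    ((h.continuousOn.mono hsub).norm.intervalIntegrable_of_Icc ht.1).const_mul K
  have hei : IntervalIntegrable e volume a t :=
    he.mono_set (uIcc_subset_uIcc left_mem_uIcc (Icc_subset_uIcc ht))
  have hint : ‖∫ s in a..t, w' s‖ ≤ ∫ s in a..t, (K * ‖w s‖ + e s) := by
    refine intervalIntegral.norm_integral_le_of_norm_le ht.1 ?_ (hwi.add hei)
    filter_upwards [(ae_restrict_iff' measurableSet_Icc).1 hw] with s hs hst
    exact hs (hsub (Ioc_subset_Icc_self hst))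
  rw [intervalIntegral.integral_add hwi hei, intervalIntegral.integral_const_mul] at hint
  have he_le : ∫ s in a..t, e s ≤ ∫ s in a..b, e s :=
    intervalIntegral.integral_mono_interval le_rfl ht.1 ht.2 (Eventually.of_forall he₀) he
  have hnorm : ‖w t‖ ≤ ‖w a‖ + ‖∫ s in a..t, w' s‖ := by
    rw [h.2 t ht]
    exact norm_add_le _ _
  linarith

theorem HasW11Deriv.norm_le (h : HasW11Deriv a b w w') {K : ℝ} {e : ℝ → ℝ} (hK : 0 ≤ K)
    (he : IntervalIntegrable e volume a b) (he₀ : ∀ t, 0 ≤ e t)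
    (hw : ∀ᵐ t ∂volume.restrict (Icc a b), ‖w' t‖ ≤ K * ‖w t‖ + e t) {t : ℝ} (ht : t ∈ Icc a b) :
    ‖w t‖ ≤ (‖w a‖ + ∫ s in a..b, e s) * Real.exp (K * (b - a)) := by
  have he_nonneg : 0 ≤ ∫ s in a..b, e s :=
    intervalIntegral.integral_nonneg (ht.1.trans ht.2) fun s _ => he₀ s
  refine (le_mul_exp_of_le_add_mul_integral hK (by positivity) h.continuousOn.norm
    (fun _ _ => norm_nonneg _) (fun s hs => h.norm_le_add_integral he he₀ hw hs) t ht).trans ?_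
  gcongr
  exact ht.2

end Arcs

/-! ### The product rule -/

section ProductRule

theorem absolutelyContinuousOnInterval_of_dist_le {X Y : Type*} [PseudoMetricSpace X]
    [PseudoMetricSpace Y] {a b : ℝ} {f : ℝ → X} {k : ℝ → Y}
    (hk : AbsolutelyContinuousOnInterval k a b)
    (h : ∀ s ∈ uIcc a b, ∀ t ∈ uIcc a b, dist (f s) (f t) ≤ dist (k s) (k t)) :
    AbsolutelyContinuousOnInterval f a b := by
  rw [absolutelyContinuousOnInterval_iff] at hk ⊢
  intro ε hε
  obtain ⟨δ, hδ, hkδ⟩ := hk ε hε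
  refine ⟨δ, hδ, fun E hE hl => (Finset.sum_le_sum fun i hi => ?_).trans_lt (hkδ E hE hl)⟩
  exact h _ (hE.1 i hi).1 _ (hE.1 i hi).2

variable {a b : ℝ}

theorem absolutelyContinuousOnInterval_norm {X : Type*} [NormedAddCommGroup X] {v : ℝ → X}
    (hv : AbsolutelyContinuousOnInterval v a b) :
    AbsolutelyContinuousOnInterval (fun t => ‖v t‖) a b :=
  absolutelyContinuousOnInterval_of_dist_le hv fun _ _ _ _ => by
    rw [Real.dist_eq, dist_eq_norm]
    exact abs_norm_sub_norm_le _ _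

variable {H : Type*} [NormedAddCommGroup H] [InnerProductSpace ℝ H] {v v' w w' : ℝ → H}

theorem absolutelyContinuousOnInterval_inner (hv : AbsolutelyContinuousOnInterval v a b)
    (hw : AbsolutelyContinuousOnInterval w a b) :
    AbsolutelyContinuousOnInterval (fun t => inner ℝ (v t) (w t)) a b := by
  have hv_norm := absolutelyContinuousOnInterval_norm hv
  have hw_norm := absolutelyContinuousOnInterval_norm hw
  have hsub_norm := absolutelyContinuousOnInterval_norm (hv.sub hw)
  simp only [real_inner_eq_norm_mul_self_add_norm_mul_self_sub_norm_sub_mul_self_div_two,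
    div_eq_inv_mul]
  exact (((hv_norm.mul hv_norm).add (hw_norm.mul hw_norm)).sub
    (hsub_norm.mul hsub_norm)).const_mul 2⁻¹

theorem HasW11Deriv.absolutelyContinuousOnInterval {X : Type*} [NormedAddCommGroup X]
    [NormedSpace ℝ X] {x x' : ℝ → X} (hab : a ≤ b) (hx : HasW11Deriv a b x x') :
    AbsolutelyContinuousOnInterval x a b := by
  refine absolutelyContinuousOnInterval_of_dist_le
    (hx.1.norm.absolutelyContinuousOnInterval_intervalIntegral (c := a) left_mem_uIcc) ?_
  rw [uIcc_of_le hab]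
  intro s hs t ht
  have ha : a ∈ Icc a b := ⟨le_rfl, hab⟩
  rw [dist_comm, dist_eq_norm, dist_comm, Real.dist_eq,
    intervalIntegral.integral_interval_sub_left (hx.intervalIntegrable ha ht).norm
      (hx.intervalIntegrable ha hs).norm]
  exact hx.norm_sub_le hs ht

theorem HasW11Deriv.ae_hasDerivAt {X : Type*} [NormedAddCommGroup X] [NormedSpace ℝ X]
    [CompleteSpace X] {x x' : ℝ → X} (hx : HasW11Deriv a b x x') :
    ∀ᵐ t, t ∈ Ioo a b → HasDerivAt x (x' t) t := by
  filter_upwards [hx.1.ae_hasDerivAt_integral] with t ht htab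
  have hta : t ∈ uIcc a b := Icc_subset_uIcc (Ioo_subset_Icc_self htab)
  refine ((ht hta a left_mem_uIcc).const_add (x a)).congr_of_eventuallyEq ?_
  filter_upwards [Ioo_mem_nhds htab.1 htab.2] with s hs
  exact hx.2 s (Ioo_subset_Icc_self hs)

theorem HasW11Deriv.inner_sub_inner [CompleteSpace H] (hab : a ≤ b) (hv : HasW11Deriv a b v v')
    (hw : HasW11Deriv a b w w') :
    inner ℝ (v b) (w b) - inner ℝ (v a) (w a) =
      ∫ t in a..b, (inner ℝ (v' t) (w t) + inner ℝ (v t) (w' t)) := by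
  rw [← (absolutelyContinuousOnInterval_inner (hv.absolutelyContinuousOnInterval hab)
    (hw.absolutelyContinuousOnInterval hab)).integral_deriv_eq_sub]
  refine intervalIntegral.integral_congr_ae_restrict ?_
  rw [uIoc_of_le hab, ← restrict_Ioo_eq_restrict_Ioc, EventuallyEq,
    ae_restrict_iff' measurableSet_Ioo]
  filter_upwards [hv.ae_hasDerivAt, hw.ae_hasDerivAt] with t hvt hwt ht
  rw [((hvt ht).inner ℝ (hwt ht)).deriv, add_comm]

end ProductRule

/-! ### Carathéodory differential equations -/

/-- The right-hand sides `F` for which `ẏ = F(t, y)` is globally well posed: measurable in time,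
`K`-Lipschitz in the state, and bounded by `M` along the zero state. -/
structure IsCaratheodory {X : Type*} [NormedAddCommGroup X] (F : ℝ → X → X) (K M : ℝ) : Prop where
  nonneg : 0 ≤ K
  meas : ∀ x, StronglyMeasurable fun t => F t x
  lip : ∀ t x y, ‖F t x - F t y‖ ≤ K * ‖x - y‖
  bound : ∀ t, ‖F t 0‖ ≤ M

namespace IsCaratheodory

section Estimates

variable {X : Type*} [NormedAddCommGroup X] {F : ℝ → X → X} {K M : ℝ}

theorem bound_nonneg (hF : IsCaratheodory F K M) : 0 ≤ M :=
  (norm_nonneg _).trans (hF.bound 0)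

theorem comp_const_sub (hF : IsCaratheodory F K M) (c : ℝ) :
    IsCaratheodory (fun t => F (c - t)) K M where
  nonneg := hF.nonneg
  meas x := (hF.meas x).comp_measurable (measurable_const.sub measurable_id)
  lip t := hF.lip (c - t)
  bound t := hF.bound (c - t)

theorem continuous (hF : IsCaratheodory F K M) (t : ℝ) : Continuous (F t) :=
  (LipschitzWith.of_dist_le_mul (K := ⟨K, hF.nonneg⟩) fun x y => by
    rw [dist_eq_norm, dist_eq_norm]
    exact hF.lip t x y).continuous

theorem norm_le (hF : IsCaratheodory F K M) (t : ℝ) (x : X) : ‖F t x‖ ≤ K * ‖x‖ + M := by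
  have hlip := hF.lip t x 0
  rw [sub_zero] at hlip
  linarith [norm_le_norm_sub_add (F t x) (F t 0), hF.bound t]

theorem stronglyMeasurable_comp [SecondCountableTopology X] (hF : IsCaratheodory F K M) {y : ℝ → X}
    (hy : StronglyMeasurable y) : StronglyMeasurable fun t => F t (y t) := by
  borelize X
  exact (stronglyMeasurable_uncurry_of_continuous_of_stronglyMeasurable (u := fun x t => F t x)
    hF.continuous hF.meas).comp_measurable (hy.measurable.prodMk measurable_id)

theorem measurable_comp {Ω : Type*} [MeasurableSpace Ω] [SecondCountableTopology X]
    [MeasurableSpace X] [BorelSpace X] {F : Ω → ℝ → X → X} {M : Ω → ℝ}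
    (hF : ∀ ω, IsCaratheodory (F ω) K (M ω)) (hFm : ∀ x, Measurable fun z : ℝ × Ω => F z.2 z.1 x)
    {Y : ℝ × Ω → X} (hY : Measurable Y) : Measurable fun z : ℝ × Ω => F z.2 z.1 (Y z) :=
  (measurable_uncurry_of_continuous_of_measurable (u := fun x (z : ℝ × Ω) => F z.2 z.1 x)
    (fun z => (hF z.2).continuous z.1) hFm).comp (hY.prodMk measurable_id)

theorem intervalIntegrable [SecondCountableTopology X] (hF : IsCaratheodory F K M) {y : ℝ → X}
    {s t : ℝ} (hy : ContinuousOn y (uIcc s t)) :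
    IntervalIntegrable (fun r => F r (y r)) volume s t := by
  have hy_meas : AEStronglyMeasurable y (volume.restrict (uIoc s t)) :=
    (hy.mono uIoc_subset_uIcc).aestronglyMeasurable measurableSet_uIoc
  refine IntervalIntegrable.mono_fun' (g := fun r => K * ‖y r‖ + M)
    ((hy.norm.const_mul K).add continuousOn_const).intervalIntegrable
    ⟨_, hF.stronglyMeasurable_comp hy_meas.stronglyMeasurable_mk, ?_⟩
    (Eventually.of_forall fun r => hF.norm_le r (y r))
  exact hy_meas.ae_eq_mk.mono fun r hr => congrArg (F r) hr

variable [NormedSpace ℝ X] {a b : ℝ} {y z z' : ℝ → X}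

theorem norm_solution_le (hF : IsCaratheodory F K M)
    (hy : HasW11Deriv a b y fun t => F t (y t)) {t : ℝ} (ht : t ∈ Icc a b) :
    ‖y t‖ ≤ (‖y a‖ + M * (b - a)) * Real.exp (K * (b - a)) := by
  have hle := hy.norm_le hF.nonneg (e := fun _ => M) intervalIntegrable_const
    (fun _ => hF.bound_nonneg) (Eventually.of_forall fun t => hF.norm_le t (y t)) ht
  rwa [intervalIntegral.integral_const, smul_eq_mul, mul_comm (b - a)] at hle

theorem norm_solution_sub_le (hF : IsCaratheodory F K M)
    (hy : HasW11Deriv a b y fun t => F t (y t)) (hz : HasW11Deriv a b z z') {η : ℝ} (hη : 0 ≤ η)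
    (hzF : ∀ᵐ t ∂volume.restrict (Icc a b), ‖F t (z t) - z' t‖ ≤ η) {t : ℝ} (ht : t ∈ Icc a b) :
    ‖y t - z t‖ ≤ (‖y a - z a‖ + η * (b - a)) * Real.exp (K * (b - a)) := by
  have hle := (hy.sub hz).norm_le hF.nonneg (e := fun _ => η) intervalIntegrable_const
    (fun _ => hη) (hzF.mono fun t ht => by
      have := norm_sub_le_norm_sub_add_norm_sub (F t (y t)) (F t (z t)) (z' t)
      linarith [hF.lip t (y t) (z t)]) ht
  rwa [intervalIntegral.integral_const, smul_eq_mul, mul_comm (b - a)] at hle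

theorem eqOn_of_hasW11Deriv (hF : IsCaratheodory F K M)
    (hy : HasW11Deriv a b y fun t => F t (y t)) (hz : HasW11Deriv a b z z')
    (hzF : ∀ᵐ t ∂volume.restrict (Icc a b), z' t = F t (z t)) (hyz : y a = z a) :
    EqOn y z (Icc a b) := by
  intro t ht
  have hle := hF.norm_solution_sub_le hy hz le_rfl (hzF.mono fun t ht => by simp [ht]) ht
  rw [hyz, sub_self, norm_zero, zero_mul, zero_add, zero_mul] at hle
  exact sub_eq_zero.1 (norm_le_zero_iff.1 hle)

end Estimates

end IsCaratheodory

section Picard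

variable {X : Type*} [NormedAddCommGroup X] [NormedSpace ℝ X]

theorem max_min_mem_Icc {a b : ℝ} (hab : a ≤ b) (t : ℝ) : max a (min b t) ∈ Icc a b :=
  ⟨le_max_left _ _, max_le hab (min_le_left _ _)⟩

theorem max_min_eq_self {a b t : ℝ} (ht : t ∈ Icc a b) : max a (min b t) = t := by
  rw [min_eq_right ht.2, max_eq_right ht.1]

/-- The Picard iterates of `ẏ = F(t, y)`, `y(a) = y₀`, on `[a, b]`. They are frozen outside
`[a, b]`, so that they are continuous and converge uniformly on the whole line. -/
noncomputable def picardIter (F : ℝ → X → X) (a b : ℝ) (y₀ : X) : ℕ → ℝ → X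
  | 0 => fun _ => y₀
  | k + 1 => fun t => y₀ + ∫ s in a..max a (min b t), F s (picardIter F a b y₀ k s)

/-- The solution of `ẏ = F(t, y)`, `y(a) = y₀`, on `[a, b]`, as the limit of the Picard iterates. It
is frozen outside `[a, b]`. -/
noncomputable def picardSol (F : ℝ → X → X) (a b : ℝ) (y₀ : X) (t : ℝ) : X :=
  limUnder atTop fun k => picardIter F a b y₀ k t

variable {F : ℝ → X → X} {K M a b : ℝ}

theorem picardIter_max_min (F : ℝ → X → X) (hab : a ≤ b) (y₀ : X) (k : ℕ) (t : ℝ) :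
    picardIter F a b y₀ k (max a (min b t)) = picardIter F a b y₀ k t := by
  cases k with
  | zero => rfl
  | succ k => simp only [picardIter, max_min_eq_self (max_min_mem_Icc hab t)]

theorem picardSol_max_min (F : ℝ → X → X) (hab : a ≤ b) (y₀ : X) (t : ℝ) :
    picardSol F a b y₀ (max a (min b t)) = picardSol F a b y₀ t := by
  simp only [picardSol, picardIter_max_min F hab]

theorem integral_mul_exp_le (K a t : ℝ) :
    ∫ s in a..t, K * Real.exp (2 * K * (s - a)) ≤ 2⁻¹ * Real.exp (2 * K * (t - a)) := by
  have hderiv : ∀ s, HasDerivAt (fun s => 2⁻¹ * Real.exp (2 * K * (s - a)))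
      (K * Real.exp (2 * K * (s - a))) s := fun s => by
    have hlin : HasDerivAt (fun s => 2 * K * (s - a)) (2 * K) s := by
      simpa using ((hasDerivAt_id s).sub_const a).const_mul (2 * K)
    convert! hlin.exp.const_mul 2⁻¹ using 1
    ring
  rw [intervalIntegral.integral_eq_sub_of_hasDerivAt (fun s _ => hderiv s)
    (Continuous.intervalIntegrable (by fun_prop) _ _)]
  linarith [Real.exp_pos (2 * K * (a - a))]

variable [SecondCountableTopology X]

namespace IsCaratheodory

theorem continuous_picardIter (hF : IsCaratheodory F K M) (y₀ : X) (k : ℕ) :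
    Continuous (picardIter F a b y₀ k) := by
  induction k with
  | zero => exact continuous_const
  | succ k ih =>
    have hprim := intervalIntegral.continuous_primitive
      (fun _ _ => hF.intervalIntegrable ih.continuousOn) a
    exact continuous_const.add (hprim.comp (by fun_prop))

/-- In the norm weighted by `exp (-2K(t - a))`, the Picard map contracts by a factor `2`. -/
theorem norm_integral_sub_le (hF : IsCaratheodory F K M) {y z : ℝ → X} (hy : Continuous y)
    (hz : Continuous z) {C : ℝ} (hC : 0 ≤ C)
    (h : ∀ t ∈ Icc a b, ‖y t - z t‖ ≤ C * Real.exp (2 * K * (t - a))) {t : ℝ} (ht : t ∈ Icc a b) :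
    ‖(∫ s in a..t, F s (y s)) - ∫ s in a..t, F s (z s)‖ ≤
      C * 2⁻¹ * Real.exp (2 * K * (t - a)) := by
  rw [← intervalIntegral.integral_sub (hF.intervalIntegrable hy.continuousOn)
    (hF.intervalIntegrable hz.continuousOn)]
  calc ‖∫ s in a..t, (F s (y s) - F s (z s))‖
      ≤ ∫ s in a..t, C * (K * Real.exp (2 * K * (s - a))) := by
        refine intervalIntegral.norm_integral_le_of_norm_le ht.1
          (Eventually.of_forall fun s hs => (hF.lip s _ _).trans ?_)
          (Continuous.intervalIntegrable (by fun_prop) _ _)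
        rw [mul_left_comm]
        exact mul_le_mul_of_nonneg_left (h s ⟨hs.1.le, hs.2.trans ht.2⟩) hF.nonneg
    _ ≤ C * (2⁻¹ * Real.exp (2 * K * (t - a))) := by
        rw [intervalIntegral.integral_const_mul]
        exact mul_le_mul_of_nonneg_left (integral_mul_exp_le K a t) hC
    _ = C * 2⁻¹ * Real.exp (2 * K * (t - a)) := (mul_assoc _ _ _).symm

theorem norm_picardIter_succ_sub_le (hF : IsCaratheodory F K M) (y₀ : X) (k : ℕ) {t : ℝ}
    (ht : t ∈ Icc a b) :
    ‖picardIter F a b y₀ (k + 1) t - picardIter F a b y₀ k t‖ ≤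
      (K * ‖y₀‖ + M) * (b - a) * 2⁻¹ ^ k * Real.exp (2 * K * (t - a)) := by
  have hK := hF.nonneg
  have hM := hF.bound_nonneg
  have hba : 0 ≤ b - a := sub_nonneg.2 (ht.1.trans ht.2)
  induction k generalizing t with
  | zero =>
    simp only [picardIter, max_min_eq_self ht, add_sub_cancel_left, pow_zero, mul_one]
    have hexp : 1 ≤ Real.exp (2 * K * (t - a)) :=
      Real.one_le_exp (mul_nonneg (by positivity) (sub_nonneg.2 ht.1))
    calc ‖∫ s in a..t, F s y₀‖ ≤ (K * ‖y₀‖ + M) * |t - a| :=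
          intervalIntegral.norm_integral_le_of_norm_le_const fun s _ => hF.norm_le s y₀
      _ ≤ (K * ‖y₀‖ + M) * (b - a) := by
          rw [abs_of_nonneg (sub_nonneg.2 ht.1)]
          gcongr
          exact ht.2
      _ ≤ (K * ‖y₀‖ + M) * (b - a) * Real.exp (2 * K * (t - a)) :=
          le_mul_of_one_le_right (by positivity) hexp
  | succ k ih =>
    have hstep := hF.norm_integral_sub_le (hF.continuous_picardIter y₀ (k + 1))
      (hF.continuous_picardIter y₀ k) (by positivity) (fun t ht => ih ht) ht
    rw [pow_succ, ← mul_assoc]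
    simpa only [picardIter, max_min_eq_self ht, add_sub_add_left_eq_sub] using hstep

variable [CompleteSpace X]

theorem tendsto_picardIter (hF : IsCaratheodory F K M) (hab : a ≤ b) (y₀ : X) (t : ℝ) :
    Tendsto (fun k => picardIter F a b y₀ k t) atTop (𝓝 (picardSol F a b y₀ t)) := by
  refine (cauchySeq_of_le_geometric 2⁻¹ ((K * ‖y₀‖ + M) * (b - a) *
    Real.exp (2 * K * (max a (min b t) - a))) (by norm_num) fun k => ?_).tendsto_limUnder
  rw [← picardIter_max_min F hab, ← picardIter_max_min F hab y₀ (k + 1), dist_comm, dist_eq_norm,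
    mul_right_comm]
  exact hF.norm_picardIter_succ_sub_le y₀ k (max_min_mem_Icc hab t)

theorem norm_picardIter_sub_picardSol_le (hF : IsCaratheodory F K M) (y₀ : X) (k : ℕ) {t : ℝ}
    (ht : t ∈ Icc a b) :
    ‖picardIter F a b y₀ k t - picardSol F a b y₀ t‖ ≤
      (K * ‖y₀‖ + M) * (b - a) * 2 * 2⁻¹ ^ k * Real.exp (2 * K * (t - a)) := by
  have hdist := dist_le_of_le_geometric_of_tendsto 2⁻¹
    ((K * ‖y₀‖ + M) * (b - a) * Real.exp (2 * K * (t - a))) (by norm_num) (fun k => by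
      rw [dist_comm, dist_eq_norm, mul_right_comm]
      exact hF.norm_picardIter_succ_sub_le y₀ k ht)
    (hF.tendsto_picardIter (ht.1.trans ht.2) y₀ t) k
  rw [dist_eq_norm] at hdist
  refine hdist.trans_eq ?_
  norm_num
  ring

theorem tendsto_const_mul_two_inv_pow_mul (C D : ℝ) :
    Tendsto (fun k : ℕ => C * 2⁻¹ ^ k * D) atTop (𝓝 0) := by
  have hpow := tendsto_pow_atTop_nhds_zero_of_lt_one (r := (2⁻¹ : ℝ)) (by norm_num) (by norm_num)
  simpa using (hpow.const_mul C).mul_const D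

theorem continuous_picardSol (hF : IsCaratheodory F K M) (hab : a ≤ b) (y₀ : X) :
    Continuous (picardSol F a b y₀) := by
  have hunif : TendstoUniformly (picardIter F a b y₀) (picardSol F a b y₀) atTop := by
    rw [Metric.tendstoUniformly_iff]
    intro ε hε
    filter_upwards [(tendsto_const_mul_two_inv_pow_mul ((K * ‖y₀‖ + M) * (b - a) * 2)
      (Real.exp (2 * K * (b - a)))).eventually_lt_const hε] with k hk t
    have hK := hF.nonneg
    have hM := hF.bound_nonneg
    have : 0 ≤ b - a := sub_nonneg.2 hab
    rw [dist_comm, dist_eq_norm, ← picardSol_max_min F hab, ← picardIter_max_min F hab]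
    refine ((hF.norm_picardIter_sub_picardSol_le y₀ k (max_min_mem_Icc hab t)).trans ?_).trans_lt hk
    gcongr
    exact (max_min_mem_Icc hab t).2
  exact hunif.continuous (Frequently.of_forall fun k => hF.continuous_picardIter y₀ k)

theorem picardSol_eq (hF : IsCaratheodory F K M) (y₀ : X) {t : ℝ} (ht : t ∈ Icc a b) :
    picardSol F a b y₀ t = y₀ + ∫ s in a..t, F s (picardSol F a b y₀ s) := by
  have hab : a ≤ b := ht.1.trans ht.2
  have hK := hF.nonneg
  have hM := hF.bound_nonneg
  have : 0 ≤ b - a := sub_nonneg.2 hab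
  refine tendsto_nhds_unique
    ((hF.tendsto_picardIter hab y₀ t).comp (tendsto_add_atTop_nat 1)) ?_
  simp only [Function.comp_def, picardIter, max_min_eq_self ht]
  refine tendsto_const_nhds.add (tendsto_iff_norm_sub_tendsto_zero.2 ?_)
  refine squeeze_zero (fun _ => norm_nonneg _) (fun k => hF.norm_integral_sub_le
    (hF.continuous_picardIter y₀ k) (hF.continuous_picardSol hab y₀) (by positivity)
    (fun s hs => hF.norm_picardIter_sub_picardSol_le y₀ k hs) ht) ?_
  simpa using (tendsto_const_mul_two_inv_pow_mul ((K * ‖y₀‖ + M) * (b - a) * 2) 2⁻¹).mul_const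
    (Real.exp (2 * K * (t - a)))

theorem picardSol_left (hF : IsCaratheodory F K M) (hab : a ≤ b) (y₀ : X) :
    picardSol F a b y₀ a = y₀ := by
  simpa using hF.picardSol_eq y₀ (left_mem_Icc.2 hab)

theorem hasW11Deriv_picardSol (hF : IsCaratheodory F K M) (hab : a ≤ b) (y₀ : X) :
    HasW11Deriv a b (picardSol F a b y₀) fun t => F t (picardSol F a b y₀ t) :=
  ⟨hF.intervalIntegrable (hF.continuous_picardSol hab y₀).continuousOn, fun t ht => by
    rw [hF.picardSol_left hab, ← hF.picardSol_eq y₀ ht]⟩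

theorem eqOn_picardSol (hF : IsCaratheodory F K M) {z z' : ℝ → X} (hz : HasW11Deriv a b z z')
    (hzF : ∀ᵐ t ∂volume.restrict (Icc a b), z' t = F t (z t)) (hab : a ≤ b) :
    EqOn (picardSol F a b (z a)) z (Icc a b) :=
  hF.eqOn_of_hasW11Deriv (hF.hasW11Deriv_picardSol hab _) hz hzF (hF.picardSol_left hab _)

theorem norm_picardSol_le (hF : IsCaratheodory F K M) (hab : a ≤ b) (y₀ : X) (t : ℝ) :
    ‖picardSol F a b y₀ t‖ ≤ (‖y₀‖ + M * (b - a)) * Real.exp (K * (b - a)) := by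
  have hle := hF.norm_solution_le (hF.hasW11Deriv_picardSol hab y₀) (max_min_mem_Icc hab t)
  rwa [hF.picardSol_left hab, picardSol_max_min F hab] at hle

end IsCaratheodory

section Parameters

variable {Ω : Type*} [MeasurableSpace Ω] [MeasurableSpace X] [BorelSpace X]
  {F : Ω → ℝ → X → X} {K : ℝ} {M : Ω → ℝ} {y₀ : Ω → X}

theorem measurable_picardIter (hF : ∀ ω, IsCaratheodory (F ω) K (M ω))
    (hFm : ∀ x, Measurable fun z : ℝ × Ω => F z.2 z.1 x) (hy₀ : Measurable y₀) (k : ℕ) :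
    Measurable fun z : ℝ × Ω => picardIter (F z.2) a b (y₀ z.2) k z.1 := by
  induction k with
  | zero => exact hy₀.comp measurable_snd
  | succ k ih =>
    refine measurable_uncurry_of_continuous_of_measurable
      (u := fun t ω => picardIter (F ω) a b (y₀ ω) (k + 1) t)
      (fun ω => (hF ω).continuous_picardIter (y₀ ω) (k + 1)) fun t => hy₀.add ?_
    simp only [intervalIntegral.integral_of_le (le_max_left a (min b t))]
    exact ((IsCaratheodory.measurable_comp hF hFm ih).stronglyMeasurable.integral_prod_left'
      (μ := volume.restrict (Ioc a (max a (min b t))))).measurable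

theorem measurable_picardSol [CompleteSpace X] (hF : ∀ ω, IsCaratheodory (F ω) K (M ω))
    (hFm : ∀ x, Measurable fun z : ℝ × Ω => F z.2 z.1 x) (hab : a ≤ b) (hy₀ : Measurable y₀) :
    Measurable fun z : ℝ × Ω => picardSol (F z.2) a b (y₀ z.2) z.1 :=
  measurable_of_tendsto_metrizable (measurable_picardIter hF hFm hy₀)
    (tendsto_pi_nhds.2 fun z => (hF z.2).tendsto_picardIter hab (y₀ z.2) z.1)

end Parameters

end Picard

/-! ### Linear equations -/

section LinearFlow

variable {X : Type*} [NormedAddCommGroup X] [NormedSpace ℝ X] {A B : ℝ → X →L[ℝ] X}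
  {K M a b : ℝ}

theorem HasW11Deriv.add {w w' z z' : ℝ → X} (h : HasW11Deriv a b w w')
    (hz : HasW11Deriv a b z z') : HasW11Deriv a b (fun t => w t + z t) fun t => w' t + z' t := by
  simpa using h.sub (hz.const_smul (-1))

theorem HasW11Deriv.comp_add_sub {x x' : ℝ → X} (h : HasW11Deriv a b x x') :
    HasW11Deriv a b (fun t => x (a + b - t)) fun t => -x' (a + b - t) := by
  refine ⟨?_, fun t ht => ?_⟩
  · have hint := (h.1.comp_sub_left (a + b)).symm.neg
    rwa [add_sub_cancel_left, add_sub_cancel_right] at hint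
  · have hsub := h.sub_eq (s := a + b - t) (t := b) ⟨by linarith [ht.2], by linarith [ht.1]⟩
      ⟨ht.1.trans ht.2, le_rfl⟩
    dsimp only
    rw [intervalIntegral.integral_neg, intervalIntegral.integral_comp_sub_left x' (a + b),
      add_sub_cancel_left, ← hsub, ← sub_eq_add_neg, sub_sub_cancel]

theorem IsEvolutionOperator.congr {G : ℝ → ℝ → X →L[ℝ] X} (hG : IsEvolutionOperator B a b G)
    (hAB : ∀ᵐ t ∂volume.restrict (Icc a b), A t = B t) : IsEvolutionOperator A a b G := by
  refine fun t ht => ⟨(hG t ht).1, fun ψ => ((hG t ht).2 ψ).congr ht.2 (fun _ _ => rfl) ?_⟩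
  filter_upwards [ae_mono (Measure.restrict_mono (Icc_subset_Icc_left ht.1) le_rfl) hAB]
    with s hs
  rw [hs]

namespace IsCaratheodory

theorem of_opNorm_le (hK : 0 ≤ K) (hB : ∀ x, StronglyMeasurable fun t => B t x)
    (hBK : ∀ t, ‖B t‖ ≤ K) : IsCaratheodory (fun t x => B t x) K 0 where
  nonneg := hK
  meas := hB
  lip t x y := by
    rw [← map_sub]
    exact (B t).le_of_opNorm_le (hBK t) _
  bound t := by rw [map_zero, norm_zero]

theorem opNorm_le (hB : IsCaratheodory (fun t x => B t x) K M) (t : ℝ) : ‖B t‖ ≤ K :=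
  (B t).opNorm_le_bound hB.nonneg fun x => by simpa using hB.lip t x 0

variable [SecondCountableTopology X] [CompleteSpace X]

theorem picardSol_add (hB : IsCaratheodory (fun t x => B t x) K M) (hab : a ≤ b) (x y : X)
    (t : ℝ) : picardSol (fun t x => B t x) a b (x + y) t =
      picardSol (fun t x => B t x) a b x t + picardSol (fun t x => B t x) a b y t := by
  have hsum := (hB.hasW11Deriv_picardSol hab x).add (hB.hasW11Deriv_picardSol hab y)
  simp only [← map_add] at hsum
  have heq := hB.eqOn_picardSol hsum (Eventually.of_forall fun _ => rfl) hab
    (max_min_mem_Icc hab t)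
  simpa only [hB.picardSol_left hab, picardSol_max_min _ hab] using heq

theorem picardSol_smul (hB : IsCaratheodory (fun t x => B t x) K M) (hab : a ≤ b) (c : ℝ) (x : X)
    (t : ℝ) : picardSol (fun t x => B t x) a b (c • x) t =
      c • picardSol (fun t x => B t x) a b x t := by
  have hmul := (hB.hasW11Deriv_picardSol hab x).const_smul c
  simp only [← map_smul] at hmul
  have heq := hB.eqOn_picardSol hmul (Eventually.of_forall fun _ => rfl) hab
    (max_min_mem_Icc hab t)
  simpa only [hB.picardSol_left hab, picardSol_max_min _ hab] using heq

/-- The flow of the linear equation `ẏ = B(t) y` from time `a` to time `t ∈ [a, b]`. -/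
noncomputable def flow (hB : IsCaratheodory (fun t x => B t x) K 0) (hab : a ≤ b) (t : ℝ) :
    X →L[ℝ] X :=
  LinearMap.mkContinuous
    { toFun := fun x => picardSol (fun t x => B t x) a b x t
      map_add' := fun x y => hB.picardSol_add hab x y t
      map_smul' := fun c x => hB.picardSol_smul hab c x t }
    (Real.exp (K * (b - a)))
    fun x => (hB.norm_picardSol_le hab x t).trans_eq (by rw [zero_mul, add_zero, mul_comm])

theorem isEvolutionOperator_flow (hB : IsCaratheodory (fun t x => B t x) K 0) (a b : ℝ) :
    IsEvolutionOperator B a b fun s t => hB.flow (le_max_left t b) s := by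
  intro t ht
  refine ⟨ContinuousLinearMap.ext fun x => hB.picardSol_left (le_max_left t b) x, fun x => ?_⟩
  exact (hB.hasW11Deriv_picardSol (le_max_left t b) x).mono (left_mem_Icc.2 (le_max_left t b))
    ⟨ht.2, le_max_right t b⟩

end IsCaratheodory

end LinearFlow

/-! ### The adjoint equation -/

section Adjoint

variable {H : Type*} [NormedAddCommGroup H] [InnerProductSpace ℝ H] [CompleteSpace H]
  {A B : ℝ → H →L[ℝ] H} {K a b : ℝ}

theorem HasW11Deriv.inner_sub_inner_of_adjoint (hab : a ≤ b) {p y h : ℝ → H}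
    (hp : HasW11Deriv a b p fun t => -(ContinuousLinearMap.adjoint (A t)) (p t))
    (hy : HasW11Deriv a b y fun t => A t (y t) + h t) :
    inner ℝ (p b) (y b) - inner ℝ (p a) (y a) = ∫ t in a..b, inner ℝ (p t) (h t) := by
  rw [hp.inner_sub_inner hab hy]
  simp only [inner_neg_left, ContinuousLinearMap.adjoint_inner_left, inner_add_right,
    neg_add_cancel_left]

theorem IsEvolutionOperator.eq_adjoint_apply {G : ℝ → ℝ → H →L[ℝ] H}
    (hG : IsEvolutionOperator A a b G) {p : ℝ → H}
    (hp : HasW11Deriv a b p fun t => -(ContinuousLinearMap.adjoint (A t)) (p t)) {t : ℝ}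
    (ht : t ∈ Icc a b) : p t = ContinuousLinearMap.adjoint (G b t) (p b) := by
  refine ext_inner_right ℝ fun ψ => ?_
  have hconst := HasW11Deriv.inner_sub_inner_of_adjoint (h := 0) ht.2
    (hp.mono ht ⟨ht.1.trans ht.2, le_rfl⟩)
    (by simpa only [Pi.zero_apply, add_zero] using (hG t ht).2 ψ)
  simp only [Pi.zero_apply, inner_zero_right, intervalIntegral.integral_zero, (hG t ht).1,
    ContinuousLinearMap.id_apply] at hconst
  rw [ContinuousLinearMap.adjoint_inner_left]
  linarith

variable [SecondCountableTopology H]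

theorem measurable_of_measurable_inner {α : Type*} [MeasurableSpace α] [MeasurableSpace H]
    [BorelSpace H] {z : α → H} (hz : ∀ h : H, Measurable fun s => inner ℝ h (z s)) :
    Measurable z := by
  let coords : H → ℕ → ℝ := fun x k => inner ℝ (TopologicalSpace.denseSeq H k) x
  have hcont : Continuous coords := continuous_pi fun k => by fun_prop
  have hinj : Function.Injective coords := fun x y hxy => by
    have hinner : (fun h : H => inner ℝ h x) = fun h => inner ℝ h y :=
      (TopologicalSpace.denseRange_denseSeq H).equalizer (by fun_prop) (by fun_prop) hxy
    exact ext_inner_left ℝ (congrFun hinner)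
  exact (hcont.measurableEmbedding hinj).measurable_comp_iff.1
    (measurable_pi_iff.2 fun k => hz _)

theorem IsCaratheodory.adjoint (hB : IsCaratheodory (fun t x => B t x) K 0) :
    IsCaratheodory (fun t x => ContinuousLinearMap.adjoint (B t) x) K 0 := by
  borelize H
  refine .of_opNorm_le hB.nonneg
    (fun ψ => (measurable_of_measurable_inner fun h => ?_).stronglyMeasurable) fun t => ?_
  · simp only [ContinuousLinearMap.adjoint_inner_right]
    exact ((hB.meas h).inner stronglyMeasurable_const).measurable
  · rw [LinearIsometryEquiv.norm_map]
    exact hB.opNorm_le t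

theorem IsCaratheodory.exists_backward_solution (hB : IsCaratheodory (fun t x => B t x) K 0)
    (hab : a ≤ b) (q : H) :
    ∃ p : ℝ → H, Continuous p ∧
      HasW11Deriv a b p (fun t => -(ContinuousLinearMap.adjoint (B t)) (p t)) ∧ p b = q := by
  have hF := hB.adjoint.comp_const_sub (a + b)
  refine ⟨fun t => picardSol _ a b q (a + b - t),
    (hF.continuous_picardSol hab q).comp (by fun_prop), ?_, ?_⟩
  · simpa using (hF.hasW11Deriv_picardSol hab q).comp_add_sub
  · simpa using hF.picardSol_left hab q

end Adjoint

/-! ### Classes of functions -/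

section Classes

variable {Ω F : Type*} [MeasurableSpace Ω] [NormedAddCommGroup F] {p : ℝ≥0∞} {μ : Measure Ω}
  {φ ψ : Ω → F}

theorem toLpClass_of_memLp (h : MemLp φ p μ) : toLpClass p μ φ = h.toLp φ := dif_pos h

theorem coeFn_toLpClass (h : MemLp φ p μ) : toLpClass p μ φ =ᵐ[μ] φ := by
  rw [toLpClass_of_memLp h]
  exact h.coeFn_toLp

theorem toLpClass_congr (h : φ =ᵐ[μ] ψ) : toLpClass p μ φ = toLpClass p μ ψ := by
  by_cases hφ : MemLp φ p μ
  · have hψ := (memLp_congr_ae h).1 hφ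
    rw [toLpClass_of_memLp hφ, toLpClass_of_memLp hψ]
    exact MemLp.toLp_congr _ _ h
  · have hψ : ¬MemLp ψ p μ := fun hψ => hφ ((memLp_congr_ae h).2 hψ)
    rw [toLpClass, toLpClass, dif_neg hφ, dif_neg hψ]

theorem toLpClass_add (hφ : MemLp φ p μ) (hψ : MemLp ψ p μ) :
    toLpClass p μ φ + toLpClass p μ ψ = toLpClass p μ (fun ω => φ ω + ψ ω) := by
  rw [toLpClass_of_memLp hφ, toLpClass_of_memLp hψ]
  exact (toLpClass_of_memLp (hφ.add hψ)).symm

theorem toLpClass_sub (hφ : MemLp φ p μ) (hψ : MemLp ψ p μ) :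
    toLpClass p μ φ - toLpClass p μ ψ = toLpClass p μ (fun ω => φ ω - ψ ω) := by
  rw [toLpClass_of_memLp hφ, toLpClass_of_memLp hψ]
  exact (toLpClass_of_memLp (hφ.sub hψ)).symm

theorem norm_toLpClass_le {w : Ω → ℝ} {c : ℝ} (hw : MemLp w p μ) (hφ : AEStronglyMeasurable φ μ)
    (h : ∀ᵐ ω ∂μ, ‖φ ω‖ ≤ c * ‖w ω‖) : ‖toLpClass p μ φ‖ ≤ c * ‖toLpClass p μ w‖ := by
  refine Lp.norm_le_mul_norm_of_ae_le_mul ?_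
  filter_upwards [coeFn_toLpClass (hw.of_le_mul hφ h), coeFn_toLpClass hw, h] with ω hφω hwω hω
  rwa [hφω, hwω]

theorem norm_toLpClass_sub_le {w : Ω → ℝ} {c : ℝ} (hw : MemLp w p μ) (hφ : MemLp φ p μ)
    (hψ : MemLp ψ p μ) (h : ∀ᵐ ω ∂μ, ‖φ ω - ψ ω‖ ≤ c * ‖w ω‖) :
    ‖toLpClass p μ φ - toLpClass p μ ψ‖ ≤ c * ‖toLpClass p μ w‖ := by
  rw [toLpClass_sub hφ hψ]
  exact norm_toLpClass_le hw (hφ.sub hψ).1 h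

theorem memLp_intervalIntegral [NormedSpace ℝ F] [SecondCountableTopology F] [MeasurableSpace F]
    [BorelSpace F] {a b : ℝ} (hab : a ≤ b) {Z : ℝ → Ω → F} {w : Ω → ℝ}
    (hw : MemLp w 2 μ) (hZ : Measurable fun y : ℝ × Ω => Z y.1 y.2)
    (hZw : ∀ s ω, ‖Z s ω‖ ≤ w ω) : MemLp (fun ω => ∫ s in a..b, Z s ω) 2 μ := by
  refine (hw.mul_const |b - a|).of_le ?_ (Eventually.of_forall fun ω => ?_)
  · simp only [intervalIntegral.integral_of_le hab]
    exact (hZ.stronglyMeasurable.integral_prod_left'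
      (μ := volume.restrict (Ioc a b))).aestronglyMeasurable
  · exact (intervalIntegral.norm_integral_le_of_norm_le_const fun s _ => hZw s ω).trans
      (le_abs_self _)

end Classes

section L2

instance fact_two_ne_top : Fact ((2 : ℝ≥0∞) ≠ ∞) := ⟨ENNReal.ofNat_ne_top⟩

variable {Ω F : Type*} [MeasurableSpace Ω] [NormedAddCommGroup F] [InnerProductSpace ℝ F]
  {μ : Measure Ω}

theorem inner_toLpClass (h : Lp F 2 μ) {φ : Ω → F} (hφ : MemLp φ 2 μ) :
    inner ℝ h (toLpClass 2 μ φ) = ∫ ω, inner ℝ (h ω) (φ ω) ∂μ := by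
  rw [L2.inner_def]
  refine integral_congr_ae ?_
  filter_upwards [coeFn_toLpClass hφ] with ω hω
  rw [hω]

variable [CompleteSpace F] [SecondCountableTopology F] [MeasurableSpace F] [BorelSpace F]
  [SFinite μ]

theorem integral_inner_intervalIntegral {a b : ℝ} (hab : a ≤ b) {Z : ℝ → Ω → F} {w : Ω → ℝ}
    (hw : MemLp w 2 μ) (hZ : Measurable fun y : ℝ × Ω => Z y.1 y.2) (hZw : ∀ s ω, ‖Z s ω‖ ≤ w ω)
    (h : Lp F 2 μ) :
    ∫ ω, inner ℝ (h ω) (∫ s in a..b, Z s ω) ∂μ = ∫ s in a..b, ∫ ω, inner ℝ (h ω) (Z s ω) ∂μ := by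
  have hh : Measurable h := (Lp.stronglyMeasurable h).measurable
  have hprod : Integrable (fun y : Ω × ℝ => (inner ℝ (h y.1) (Z y.2 y.1) : ℝ))
      (μ.prod (volume.restrict (Ioc a b))) := by
    have hdom : Integrable (fun y : Ω × ℝ => ‖h y.1‖ * ‖w y.1‖ * (1 : ℝ))
        (μ.prod (volume.restrict (Ioc a b))) :=
      Integrable.mul_prod (f := fun ω => ‖h ω‖ * ‖w ω‖) (g := fun _ => (1 : ℝ))
        ((Lp.memLp h).norm.integrable_mul hw.norm) (integrable_const 1)
    refine hdom.mono ((hh.comp measurable_fst).inner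
      (hZ.comp measurable_swap)).aestronglyMeasurable (Eventually.of_forall fun y => ?_)
    rw [mul_one, norm_mul, norm_norm, norm_norm]
    exact (norm_inner_le_norm _ _).trans (mul_le_mul_of_nonneg_left
      ((hZw y.2 y.1).trans (le_abs_self _)) (norm_nonneg _))
  have hcomm : ∀ ω, inner ℝ (h ω) (∫ s in a..b, Z s ω) = ∫ s in a..b, inner ℝ (h ω) (Z s ω) := by
    intro ω
    have hint : IntervalIntegrable (fun s => Z s ω) volume a b :=
      IntervalIntegrable.mono_fun' (g := fun _ => w ω) intervalIntegrable_const
        (hZ.comp measurable_prodMk_right).aestronglyMeasurable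
        (Eventually.of_forall fun s => hZw s ω)
    exact ((innerSL ℝ (h ω)).intervalIntegral_comp_comm hint).symm
  simp only [hcomm]
  simp only [intervalIntegral.integral_of_le hab]
  exact integral_integral_swap hprod

variable [IsSeparable μ]

theorem stronglyMeasurable_toLpClass {α : Type*} [MeasurableSpace α] {Z : α → Ω → F}
    (hZ : Measurable fun z : α × Ω => Z z.1 z.2) (hZ_memLp : ∀ s, MemLp (Z s) 2 μ) :
    StronglyMeasurable fun s => toLpClass 2 μ (Z s) := by
  borelize ↥(Lp F 2 μ)
  refine (measurable_of_measurable_inner fun h => ?_).stronglyMeasurable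
  simp only [inner_toLpClass h (hZ_memLp _)]
  have hinner : Measurable fun z : α × Ω => inner ℝ (h z.2) (Z z.1 z.2) :=
    ((Lp.stronglyMeasurable h).measurable.comp measurable_snd).inner hZ
  exact hinner.stronglyMeasurable.integral_prod_right'.measurable

theorem intervalIntegrable_toLpClass {Z : ℝ → Ω → F} {w : Ω → ℝ} (hw : MemLp w 2 μ)
    (hZ : Measurable fun y : ℝ × Ω => Z y.1 y.2) (hZw : ∀ s ω, ‖Z s ω‖ ≤ w ω) (a b : ℝ) :
    IntervalIntegrable (fun s => toLpClass 2 μ (Z s)) volume a b := by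
  have hZs : ∀ s, AEStronglyMeasurable (Z s) μ := fun s =>
    (hZ.comp measurable_prodMk_left).aestronglyMeasurable
  have hle : ∀ s, ∀ᵐ ω ∂μ, ‖Z s ω‖ ≤ ‖w ω‖ := fun s =>
    Eventually.of_forall fun ω => (hZw s ω).trans (le_abs_self _)
  exact IntervalIntegrable.mono_fun' (g := fun _ => 1 * ‖toLpClass 2 μ w‖)
    intervalIntegrable_const
    (stronglyMeasurable_toLpClass hZ fun s => hw.of_le (hZs s) (hle s)).aestronglyMeasurable
    (Eventually.of_forall fun s =>
      norm_toLpClass_le hw (hZs s) ((hle s).mono fun ω hω => by rwa [one_mul]))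

theorem intervalIntegral_toLpClass {a b : ℝ} (hab : a ≤ b) {Z : ℝ → Ω → F} {w : Ω → ℝ}
    (hw : MemLp w 2 μ) (hZ : Measurable fun y : ℝ × Ω => Z y.1 y.2)
    (hZw : ∀ s ω, ‖Z s ω‖ ≤ w ω) :
    ∫ s in a..b, toLpClass 2 μ (Z s) = toLpClass 2 μ fun ω => ∫ s in a..b, Z s ω := by
  have hZs : ∀ s, MemLp (Z s) 2 μ := fun s =>
    hw.of_le (hZ.comp measurable_prodMk_left).aestronglyMeasurable
      (Eventually.of_forall fun ω => (hZw s ω).trans (le_abs_self _))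
  refine ext_inner_left ℝ fun h => ?_
  rw [inner_toLpClass h (memLp_intervalIntegral hab hw hZ hZw),
    integral_inner_intervalIntegral hab hw hZ hZw]
  simp only [← inner_toLpClass h (hZs _)]
  exact ((innerSL ℝ h).intervalIntegral_comp_comm
    (intervalIntegrable_toLpClass hw hZ hZw a b)).symm

theorem hasW11Deriv_toLpClass {a b : ℝ} {z Z : ℝ → Ω → F} {w : Ω → ℝ} (hw : MemLp w 2 μ)
    (hZ : Measurable fun y : ℝ × Ω => Z y.1 y.2) (hZw : ∀ s ω, ‖Z s ω‖ ≤ w ω)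
    (hza : MemLp (z a) 2 μ) (hz : ∀ ω, HasW11Deriv a b (fun t => z t ω) fun t => Z t ω) :
    HasW11Deriv a b (fun t => toLpClass 2 μ (z t)) fun t => toLpClass 2 μ (Z t) := by
  refine ⟨intervalIntegrable_toLpClass hw hZ hZw a b, fun t ht => ?_⟩
  rw [intervalIntegral_toLpClass ht.1 hw hZ hZw,
    toLpClass_add hza (memLp_intervalIntegral ht.1 hw hZ hZw)]
  exact congrArg _ (funext fun ω => (hz ω).2 t ht)

end L2

/-! ### Ensembles of solutions -/

section Ensemble

variable {Ω X : Type*} [MeasurableSpace Ω] [NormedAddCommGroup X]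
  [CompleteSpace X] [SecondCountableTopology X] [MeasurableSpace X] [BorelSpace X]
  {μ : Measure Ω} {F : Ω → ℝ → X → X} {K a b : ℝ} {M : Ω → ℝ} {y₀ : Ω → X}

theorem IsCaratheodory.memLp_picardSol [NormedSpace ℝ X]
    (hF : ∀ ω, IsCaratheodory (F ω) K (M ω))
    (hFm : ∀ x, Measurable fun z : ℝ × Ω => F z.2 z.1 x) (hM : MemLp M 2 μ)
    (hy₀ : Measurable y₀) (hy₀_memLp : MemLp y₀ 2 μ) (hab : a ≤ b) (t : ℝ) :
    MemLp (fun ω => picardSol (F ω) a b (y₀ ω) t) 2 μ := by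
  have hdom := (hy₀_memLp.norm.add (hM.mul_const (b - a))).mul_const (Real.exp (K * (b - a)))
  refine hdom.of_le ?_ (Eventually.of_forall fun ω => ?_)
  · exact ((measurable_picardSol hF hFm hab hy₀).comp measurable_prodMk_left).aestronglyMeasurable
  · exact ((hF ω).norm_picardSol_le hab (y₀ ω) t).trans (le_abs_self _)

theorem IsCaratheodory.hasW11Deriv_toLpClass_picardSol [InnerProductSpace ℝ X]
    [SFinite μ] [IsSeparable μ]
    (hF : ∀ ω, IsCaratheodory (F ω) K (M ω))
    (hFm : ∀ x, Measurable fun z : ℝ × Ω => F z.2 z.1 x) (hM : MemLp M 2 μ)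
    (hy₀ : Measurable y₀) (hy₀_memLp : MemLp y₀ 2 μ) (hab : a ≤ b) :
    HasW11Deriv a b (fun t => toLpClass 2 μ fun ω => picardSol (F ω) a b (y₀ ω) t)
      fun t => toLpClass 2 μ fun ω => F ω t (picardSol (F ω) a b (y₀ ω) t) := by
  have hbound := (((hy₀_memLp.norm.add (hM.mul_const (b - a))).mul_const
    (Real.exp (K * (b - a)))).const_mul K).add hM
  refine hasW11Deriv_toLpClass (z := fun t ω => picardSol (F ω) a b (y₀ ω) t)
    (Z := fun t ω => F ω t (picardSol (F ω) a b (y₀ ω) t)) hbound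
    (IsCaratheodory.measurable_comp hF hFm (measurable_picardSol hF hFm hab hy₀)) (fun s ω => ?_)
    (IsCaratheodory.memLp_picardSol hF hFm hM hy₀ hy₀_memLp hab a)
    fun ω => (hF ω).hasW11Deriv_picardSol hab (y₀ ω)
  exact ((hF ω).norm_le s _).trans (add_le_add_left (mul_le_mul_of_nonneg_left
    ((hF ω).norm_picardSol_le hab (y₀ ω) s) (hF ω).nonneg) _)

end Ensemble

/-! ### Measurable selection -/

section Capacitability

variable {X : Type*} {g : (ℕ → ℕ) → X}

theorem exists_lt_measure_image_inter_le [MeasurableSpace X] {μ : Measure X} {c : ℝ≥0∞}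
    {S : Set (ℕ → ℕ)} (hS : c < μ (g '' S)) (k : ℕ) :
    ∃ j, c < μ (g '' (S ∩ {x | x k ≤ j})) := by
  have hmono : Monotone fun j => g '' (S ∩ {x | x k ≤ j}) := fun i j hij =>
    image_mono (inter_subset_inter_right _ fun x hx => le_trans hx hij)
  have hunion : g '' S = ⋃ j, g '' (S ∩ {x | x k ≤ j}) := by
    rw [← image_iUnion, ← inter_iUnion]
    exact congrArg _ (inter_eq_left.2 fun x _ => mem_iUnion.2 ⟨x k, le_refl (x k)⟩).symm
  rw [hunion, hmono.measure_iUnion] at hS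
  exact lt_iSup_iff.1 hS

theorem exists_forall_lt_measure_image_pi_Iio [MeasurableSpace X] {μ : Measure X} {c : ℝ≥0∞}
    (hc : c < μ (range g)) :
    ∃ n : ℕ → ℕ, ∀ k, c < μ (g '' (Iio k).pi fun i => Iic (n i)) := by
  have hstep : ∀ (S : Set (ℕ → ℕ)) (k : ℕ), ∃ j, c < μ (g '' S) →
      c < μ (g '' (S ∩ {x | x k ≤ j})) := fun S k => by
    by_cases hS : c < μ (g '' S)
    · exact (exists_lt_measure_image_inter_le hS k).imp fun _ hj _ => hj
    · exact ⟨0, fun h => absurd h hS⟩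
  choose j hj using hstep
  let S : ℕ → Set (ℕ → ℕ) := fun k => Nat.rec univ (fun k S => S ∩ {x | x k ≤ j S k}) k
  have hS_eq : ∀ k, S k = (Iio k).pi fun i => Iic (j (S i) i) := fun k => by
    induction k with
    | zero => simp [S]
    | succ k ih =>
      change S k ∩ {x | x k ≤ j (S k) k} = _
      ext x
      rw [mem_inter_iff]
      nth_rewrite 1 [ih]
      simp only [Set.mem_pi, mem_Iio, mem_Iic, Nat.lt_succ_iff_lt_or_eq, or_imp, forall_and,
        forall_eq, mem_ofPred_eq]
  refine ⟨fun k => j (S k) k, fun k => hS_eq k ▸ ?_⟩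
  induction k with
  | zero => simpa [S] using hc
  | succ k ih => exact hj (S k) k ih

theorem exists_pi_Iio_subset_of_isOpen {n : ℕ → ℕ} {O : Set (ℕ → ℕ)} (hO : IsOpen O)
    (h : (univ.pi fun i => Iic (n i)) ⊆ O) : ∃ k, ((Iio k).pi fun i => Iic (n i)) ⊆ O := by
  by_contra! hno
  choose x hx hxO using fun k => not_subset.1 (hno k)
  have hK : IsCompact (univ.pi fun i => Iic (n i)) :=
    isCompact_univ_pi fun i => (finite_Iic (n i)).isCompact
  obtain ⟨z, hz, ψ, hψ, hlim⟩ := hK.tendsto_subseq (x := fun k i => min (x k i) (n i))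
    fun k i _ => mem_Iic.2 (min_le_right _ _)
  have hlim_x : Tendsto (x ∘ ψ) atTop (𝓝 z) := by
    rw [tendsto_pi_nhds] at hlim ⊢
    intro i
    refine (hlim i).congr' ?_
    filter_upwards [eventually_gt_atTop i] with k hk
    exact min_eq_left (hx (ψ k) i (hk.trans_le (hψ.id_le k)))
  obtain ⟨k, hk⟩ := (hlim_x.eventually (hO.mem_nhds (h hz))).exists
  exact hxO _ hk

theorem exists_isCompact_measure_image_ne_zero [TopologicalSpace X] [MeasurableSpace X]
    (μ : Measure X) [μ.OuterRegular] (hg : Continuous g) (h : μ (range g) ≠ 0) :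
    ∃ K : Set (ℕ → ℕ), IsCompact K ∧ μ (g '' K) ≠ 0 := by
  obtain ⟨c, hc_pos, hc⟩ := exists_between (pos_iff_ne_zero.2 h)
  obtain ⟨n, hn⟩ := exists_forall_lt_measure_image_pi_Iio hc
  refine ⟨univ.pi fun i => Iic (n i), isCompact_univ_pi fun i => (finite_Iic (n i)).isCompact,
    fun hnull => ?_⟩
  obtain ⟨O, hO, hO_open, hOc⟩ :=
    Set.exists_isOpen_lt_of_lt (g '' univ.pi fun i => Iic (n i)) c (hnull ▸ hc_pos)
  obtain ⟨k, hk⟩ := exists_pi_Iio_subset_of_isOpen (hO_open.preimage hg) (image_subset_iff.1 hO)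
  exact hOc.not_gt ((hn k).trans_le (measure_mono (image_subset_iff.2 hk)))

end Capacitability

section Selection

theorem exists_measurable_section_of_injective {C X : Type*} [TopologicalSpace C] [CompactSpace C]
    [Nonempty C] [MeasurableSpace C] [BorelSpace C] [TopologicalSpace X] [T2Space X]
    [MeasurableSpace X] [BorelSpace X] {π : C → X} (hπ : Continuous π) {e : C → ℝ}
    (he : Continuous e) (he_inj : Function.Injective e) :
    ∃ s : X → C, Measurable s ∧ ∀ x ∈ range π, π (s x) = x := by
  -- Pick in each fibre of `π` the point at which `e` is smallest.
  have hmin : ∀ x : range π, ∃ c, π c = x ∧ ∀ d, π d = x → e c ≤ e d := fun x => by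
    obtain ⟨c, hc⟩ := x.2
    have hfibre : IsClosed {c | π c = x} := isClosed_eq hπ continuous_const
    obtain ⟨d, hd, hd_min⟩ := hfibre.isCompact.exists_isMinOn ⟨c, hc⟩ he.continuousOn
    exact ⟨d, hd, fun d' hd' => hd_min hd'⟩
  choose s hs hs_min using hmin
  have hs_meas : Measurable s := by
    refine (he.isClosedEmbedding he_inj).measurableEmbedding.measurable_comp_iff.1
      (measurable_of_Iic fun r => ?_)
    have hpre : e ∘ s ⁻¹' Iic r = Subtype.val ⁻¹' (π '' {c | e c ≤ r}) := by
      ext x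
      refine ⟨fun hx => ⟨s x, hx, hs x⟩, fun ⟨c, hc, hcx⟩ => (hs_min x c hcx).trans hc⟩
    rw [hpre]
    exact measurable_subtype_coe
      ((isClosed_le he continuous_const).isCompact.image hπ).measurableSet
  obtain ⟨s', hs', hs'_eq⟩ := (MeasurableEmbedding.subtype_coe
    (isCompact_range hπ).measurableSet).exists_measurable_extend hs_meas fun _ => inferInstance
  exact ⟨s', hs', fun x hx => (congrArg π (congrFun hs'_eq ⟨x, hx⟩)).trans (hs ⟨x, hx⟩)⟩

theorem exists_measurable_section_of_compactSpace {C X : Type*} [MetricSpace C] [CompactSpace C]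
    [Nonempty C] [MeasurableSpace C] [BorelSpace C] [TopologicalSpace X] [T2Space X]
    [MeasurableSpace X] [BorelSpace X] {π : C → X} (hπ : Continuous π) :
    ∃ s : X → C, Measurable s ∧ ∀ x ∈ range π, π (s x) = x := by
  obtain ⟨F, hF, hF_surj⟩ := exists_nat_bool_continuous_surjective_of_compact C
  obtain ⟨s, hs, hs_eq⟩ := exists_measurable_section_of_injective (hπ.comp hF)
    (continuous_subtype_val.comp cantorSetHomeomorphNatToBool.symm.continuous)
    (Subtype.val_injective.comp cantorSetHomeomorphNatToBool.symm.injective)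
  rw [hF_surj.range_comp] at hs_eq
  exact ⟨F ∘ s, hF.measurable.comp hs, hs_eq⟩

variable {X V : Type*} [TopologicalSpace X] [PolishSpace X] [MeasurableSpace X] [BorelSpace X]
  [TopologicalSpace V] [PolishSpace V] [MeasurableSpace V] [BorelSpace V] {ν : Measure X}
  [ν.OuterRegular] {B : Set (X × V)}

theorem exists_measurable_section (hB : MeasurableSet B) (h : ν (Prod.fst '' B) ≠ 0) :
    ∃ (S : Set X) (v : X → V), MeasurableSet S ∧ ν S ≠ 0 ∧ Measurable v ∧
      ∀ t ∈ S, (t, v t) ∈ B := by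
  have hB_analytic := hB.analyticSet
  rw [AnalyticSet] at hB_analytic
  obtain rfl | ⟨g, hg, rfl⟩ := hB_analytic
  · simp at h
  rw [← range_comp] at h
  obtain ⟨K, hK, hK_ne⟩ :=
    exists_isCompact_measure_image_ne_zero ν (continuous_fst.comp hg) h
  have : CompactSpace K := isCompact_iff_compactSpace.1 hK
  have : Nonempty K := by
    by_contra hempty
    rw [not_nonempty_iff, isEmpty_coe_sort] at hempty
    simp [hempty] at hK_ne
  let := TopologicalSpace.metrizableSpaceMetric K
  obtain ⟨s, hs, hs_eq⟩ := exists_measurable_section_of_compactSpace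
    (π := fun c : K => (g c).1) (by fun_prop)
  refine ⟨Prod.fst ∘ g '' K, fun t => (g (s t)).2,
    (hK.image (continuous_fst.comp hg)).measurableSet, hK_ne,
    (continuous_snd.comp (hg.comp continuous_subtype_val)).measurable.comp hs, fun t ht => ?_⟩
  obtain ⟨c, hc, hct⟩ := ht
  exact ⟨s t, Prod.ext (hs_eq t ⟨⟨c, hc⟩, hct⟩) rfl⟩

theorem ae_forall_le_of_forall_integral_le (hB : MeasurableSet B) {Φ : X × V → ℝ}
    (hΦ : Measurable Φ) {u : X → V} (hu : Measurable u) (huB : ∀ᵐ t ∂ν, (t, u t) ∈ B)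
    (hint : ∀ w : X → V, Measurable w → (∀ᵐ t ∂ν, (t, w t) ∈ B) →
      Integrable (fun t => Φ (t, w t)) ν)
    (hle : ∀ w : X → V, Measurable w → (∀ᵐ t ∂ν, (t, w t) ∈ B) →
      ∫ t, Φ (t, w t) ∂ν ≤ ∫ t, Φ (t, u t) ∂ν) :
    ∀ᵐ t ∂ν, ∀ v, (t, v) ∈ B → Φ (t, v) ≤ Φ (t, u t) := by
  classical
  let E : Set (X × V) := B ∩ {z | Φ (z.1, u z.1) < Φ z}
  have hE : MeasurableSet E := hB.inter (measurableSet_lt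
    (hΦ.comp (measurable_fst.prodMk (hu.comp measurable_fst))) hΦ)
  suffices hnull : ν (Prod.fst '' E) = 0 by
    filter_upwards [measure_eq_zero_iff_ae_notMem.1 hnull] with t ht v hv
    exact not_lt.1 fun hlt => ht ⟨(t, v), ⟨hv, hlt⟩, rfl⟩
  by_contra hpos
  obtain ⟨S, v, hS, hS_ne, hv, hvE⟩ := exists_measurable_section hE hpos
  let w : X → V := S.piecewise v u
  have hw : Measurable w := hv.piecewise hS hu
  have hwB : ∀ᵐ t ∂ν, (t, w t) ∈ B := by
    filter_upwards [huB] with t ht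
    by_cases htS : t ∈ S
    · simpa only [w, piecewise_eq_of_mem _ _ _ htS] using (hvE t htS).1
    · simpa only [w, piecewise_eq_of_notMem _ _ _ htS] using ht
  have huw : ∀ t, Φ (t, u t) ≤ Φ (t, w t) := fun t => by
    by_cases htS : t ∈ S
    · simpa only [w, piecewise_eq_of_mem _ _ _ htS] using (hvE t htS).2.le
    · simp only [w, piecewise_eq_of_notMem _ _ _ htS, le_rfl]
  have heq := (integral_eq_iff_of_ae_le (hint u hu huB) (hint w hw hwB)
    (Eventually.of_forall huw)).1
    ((integral_mono (hint u hu huB) (hint w hw hwB) huw).antisymm (hle w hw hwB))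
  refine hS_ne (measure_eq_zero_iff_ae_notMem.2 (heq.mono fun t ht htS => ?_))
  dsimp only at ht
  rw [show w t = v t from piecewise_eq_of_mem _ _ _ htS] at ht
  exact (hvE t htS).2.ne ht

theorem exists_measurableSet_of_nullMeasurable_prod {α V : Type*} [MeasurableSpace α]
    [MeasurableSpace V] {μ : Measure α} {E : Set (NullMeasurableSpace α μ × V)}
    (hE : MeasurableSet E) :
    ∃ B : Set (α × V), MeasurableSet B ∧ ∀ᵐ t ∂μ, ∀ v, (t, v) ∈ E ↔ (t, v) ∈ B := by
  rw [← generateFrom_prod] at hE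
  induction E, hE using MeasurableSpace.generateFrom_induction with
  | hC S hS _ =>
    obtain ⟨A, hA, C, hC, rfl⟩ := hS
    have hA_null : NullMeasurableSet (α := α) A μ := hA
    refine ⟨toMeasurable μ A ×ˢ C, (measurableSet_toMeasurable μ A).prod hC, ?_⟩
    filter_upwards [hA_null.toMeasurable_ae_eq.mem_iff] with t ht v
    exact and_congr ht.symm Iff.rfl
  | empty => exact ⟨∅, .empty, Eventually.of_forall fun t v =>
      iff_of_false (notMem_empty _) (notMem_empty _)⟩
  | compl S _ ih =>
    obtain ⟨B, hB, hSB⟩ := ih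
    exact ⟨Bᶜ, hB.compl, hSB.mono fun t ht v => not_congr (ht v)⟩
  | iUnion S _ ih =>
    choose B hB hSB using ih
    refine ⟨⋃ i, B i, .iUnion hB, ?_⟩
    filter_upwards [ae_all_iff.2 hSB] with t ht v
    exact mem_iUnion.trans ((exists_congr fun i => ht i v).trans (mem_iUnion (s := B)).symm)

end Selection

/-! ### Control-affine dynamics -/

theorem measurable_fderiv_of_continuous_of_measurable {α E F : Type*} [MeasurableSpace α]
    [NormedAddCommGroup E] [NormedSpace ℝ E] [FiniteDimensional ℝ E] [MeasurableSpace E]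
    [BorelSpace E] [NormedAddCommGroup F] [NormedSpace ℝ F] [FiniteDimensional ℝ F]
    [MeasurableSpace F] [BorelSpace F] {f : α → E → F} (hf : ∀ a, Continuous (f a))
    (hf_meas : ∀ x, Measurable fun a => f a x) :
    Measurable fun p : α × E => fderiv ℝ (f p.1) p.2 := by
  have : ProperSpace E := FiniteDimensional.proper ℝ E
  have : ProperSpace F := FiniteDimensional.proper ℝ F
  borelize C(E, F)
  have : PolishSpace C(E, F) := by
    let := UniformSpace.pseudoMetricSpace C(E, F)
    let := MetricSpace.ofT0PseudoMetricSpace C(E, F)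
    infer_instance
  -- Evaluation at a dense sequence generates the Borel σ-algebra of the Polish space `C(E, F)`.
  let evalDense : C(E, F) → ℕ → F := fun φ k => φ (TopologicalSpace.denseSeq E k)
  have hcont : Continuous evalDense := continuous_pi fun k => by fun_prop
  have hinj : Function.Injective evalDense := fun φ ψ h =>
    DFunLike.coe_injective ((TopologicalSpace.denseRange_denseSeq E).equalizer φ.continuous
      ψ.continuous (funext fun k => congrFun h k))
  have hmeas : Measurable fun a => (⟨f a, hf a⟩ : C(E, F)) :=
    (hcont.measurableEmbedding hinj).measurable_comp_iff.1
      (measurable_pi_iff.2 fun k => hf_meas _)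
  have hfderiv := measurable_fderiv_with_param ℝ (f := fun (φ : C(E, F)) (x : E) => φ x)
    (by unfold Function.uncurry; fun_prop)
  exact hfderiv.comp ((hmeas.comp measurable_fst).prodMk measurable_snd)

section Affine

variable {Ω : Type*} {n m : ℕ} (f : Fin (m + 1) → Vec n → Ω → Vec n) (x : Vec n) (u v : Vec m)
  (ω : Ω)

theorem dyn_sub_dyn_control : dyn f x u ω - dyn f x v ω = ∑ i, (u - v) i • f i.succ x ω := by
  simp only [dyn, add_sub_add_left_eq_sub, ← Finset.sum_sub_distrib, ← sub_smul, PiLp.sub_apply]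

theorem dyn_lineMap (ε : ℝ) : dyn f x (AffineMap.lineMap u v ε) ω =
    dyn f x u ω + ε • (dyn f x v ω - dyn f x u ω) := by
  rw [← sub_eq_iff_eq_add', dyn_sub_dyn_control, dyn_sub_dyn_control, Finset.smul_sum,
    AffineMap.lineMap_apply_module', add_sub_cancel_right]
  simp only [PiLp.smul_apply, smul_eq_mul, smul_smul]

end Affine

theorem norm_sum_smul_le {m : ℕ} {E : Type*} [SeminormedAddCommGroup E] [NormedSpace ℝ E]
    (u : Vec m) {z : Fin m → E} {c : ℝ} (hz : ∀ i, ‖z i‖ ≤ c) :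
    ‖∑ i, u i • z i‖ ≤ m * ‖u‖ * c := by
  calc ‖∑ i, u i • z i‖ ≤ ∑ i, ‖u i • z i‖ := norm_sum_le _ _
    _ ≤ ∑ _i : Fin m, ‖u‖ * c := Finset.sum_le_sum fun i _ => by
      rw [norm_smul]
      exact mul_le_mul (PiLp.norm_apply_le u i) (hz i) (norm_nonneg _) (norm_nonneg _)
    _ = m * ‖u‖ * c := by simp [mul_assoc]

section LipschitzDynamics

variable {Ω : Type*} [MeasurableSpace Ω] {n m : ℕ}

/-- Vector fields which are measurable in the parameter and have linear growth and a Lipschitz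
bound in the state, with one constant `C` for all of them. -/
structure IsLipDyn (f : Fin (m + 1) → Vec n → Ω → Vec n) (C : ℝ) : Prop where
  nonneg : 0 ≤ C
  meas : ∀ i x, Measurable (f i x)
  growth : ∀ i x ω, ‖f i x ω‖ ≤ C * (1 + ‖x‖)
  lip : ∀ i x x' ω, ‖f i x ω - f i x' ω‖ ≤ C * ‖x - x'‖

theorem H0.exists_isLipDyn {f : Fin (m + 1) → Vec n → Ω → Vec n} {g : Vec n → Ω → ℝ}
    {U : ℝ → Set (Vec m)} {t₀ T : ℝ} (h0 : H0 f g U t₀ T) : ∃ C, IsLipDyn f C := by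
  choose c hc_pos hc using h0.f_growth
  choose k hk_pos hk using h0.f_lipschitz
  have hc_le : ∀ i, c i ≤ (∑ j, c j) + ∑ j, k j := fun i =>
    (Finset.single_le_sum (fun j _ => (hc_pos j).le) (Finset.mem_univ i)).trans
      (le_add_of_nonneg_right (Finset.sum_nonneg fun j _ => (hk_pos j).le))
  have hk_le : ∀ i, k i ≤ (∑ j, c j) + ∑ j, k j := fun i =>
    (Finset.single_le_sum (fun j _ => (hk_pos j).le) (Finset.mem_univ i)).trans
      (le_add_of_nonneg_left (Finset.sum_nonneg fun j _ => (hc_pos j).le))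
  exact ⟨(∑ j, c j) + ∑ j, k j, (hc_pos 0).le.trans (hc_le 0), h0.f_measurable,
    fun i x ω => (hc i x ω).trans (mul_le_mul_of_nonneg_right (hc_le i) (by positivity)),
    fun i x x' ω => (hk i x x' ω).trans (mul_le_mul_of_nonneg_right (hk_le i) (norm_nonneg _))⟩

namespace IsLipDyn

variable {f : Fin (m + 1) → Vec n → Ω → Vec n} {C : ℝ}

theorem norm_dyn_le (hf : IsLipDyn f C) (x : Vec n) (u : Vec m) (ω : Ω) :
    ‖dyn f x u ω‖ ≤ C * (1 + m * ‖u‖) * (1 + ‖x‖) := by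
  have hsum := norm_sum_smul_le u fun i => hf.growth i.succ x ω
  exact (norm_add_le _ _).trans (by linarith [hf.growth 0 x ω])

theorem norm_dyn_sub_le (hf : IsLipDyn f C) (x y : Vec n) (u : Vec m) (ω : Ω) :
    ‖dyn f x u ω - dyn f y u ω‖ ≤ C * (1 + m * ‖u‖) * ‖x - y‖ := by
  have hsplit : dyn f x u ω - dyn f y u ω =
      (f 0 x ω - f 0 y ω) + ∑ i : Fin m, u i • (f i.succ x ω - f i.succ y ω) := by
    simp only [dyn, smul_sub, Finset.sum_sub_distrib]
    abel
  have hsum := norm_sum_smul_le u fun i => hf.lip i.succ x y ω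
  rw [hsplit]
  exact (norm_add_le _ _).trans (by linarith [hf.lip 0 x y ω])

theorem norm_dyn_sub_dyn_control_le (hf : IsLipDyn f C) (x : Vec n) (u v : Vec m) (ω : Ω) :
    ‖dyn f x u ω - dyn f x v ω‖ ≤ m * ‖u - v‖ * (C * (1 + ‖x‖)) := by
  rw [dyn_sub_dyn_control]
  exact norm_sum_smul_le _ fun i => hf.growth i.succ x ω

theorem continuous (hf : IsLipDyn f C) (i : Fin (m + 1)) (ω : Ω) : Continuous fun x => f i x ω :=
  (LipschitzWith.of_dist_le_mul (K := ⟨C, hf.nonneg⟩) fun x y => by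
    rw [dist_eq_norm, dist_eq_norm]
    exact hf.lip i x y ω).continuous

theorem continuous_dyn (hf : IsLipDyn f C) (u : Vec m) (ω : Ω) : Continuous fun x => dyn f x u ω :=
  (hf.continuous 0 ω).add (continuous_finsetSum _ fun i _ =>
    (hf.continuous i.succ ω).const_smul (u i))

theorem norm_dynJac_le (hf : IsLipDyn f C) (x : Vec n) (u : Vec m) (ω : Ω) :
    ‖dynJac f x u ω‖ ≤ C * (1 + m * ‖u‖) :=
  norm_fderiv_le_of_lip' ℝ (mul_nonneg hf.nonneg (by positivity))
    (Eventually.of_forall fun y => hf.norm_dyn_sub_le y x u ω)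

section Measurability

variable {α : Type*} [MeasurableSpace α] {x : α → Vec n} {u : α → Vec m} {w : α → Ω}

theorem measurable_comp (hf : IsLipDyn f C) (i : Fin (m + 1)) (hx : Measurable x)
    (hw : Measurable w) : Measurable fun a => f i (x a) (w a) :=
  (measurable_uncurry_of_continuous_of_measurable (u := fun x ω => f i x ω) (hf.continuous i)
    (hf.meas i)).comp (hx.prodMk hw)

theorem measurable_dyn (hf : IsLipDyn f C) (hx : Measurable x) (hu : Measurable u)
    (hw : Measurable w) : Measurable fun a => dyn f (x a) (u a) (w a) := by
  refine (hf.measurable_comp 0 hx hw).add (Finset.measurable_sum _ fun i _ => ?_)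
  have hui : Measurable fun a => u a i := by fun_prop
  exact hui.smul (hf.measurable_comp i.succ hx hw)

theorem measurable_dynJac (hf : IsLipDyn f C) (hx : Measurable x) (hu : Measurable u)
    (hw : Measurable w) : Measurable fun a => dynJac f (x a) (u a) (w a) :=
  (measurable_fderiv_of_continuous_of_measurable
    (f := fun (z : Vec m × Ω) (x : Vec n) => dyn f x z.1 z.2)
    (fun z => hf.continuous_dyn z.1 z.2)
    (fun _ => hf.measurable_dyn measurable_const measurable_fst measurable_snd)).comp
      ((hu.prodMk hw).prodMk hx)

theorem measurable_dynJac_apply (hf : IsLipDyn f C) (hx : Measurable x) (hu : Measurable u)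
    (hw : Measurable w) {y : α → Vec n} (hy : Measurable y) :
    Measurable fun a => dynJac f (x a) (u a) (w a) (y a) :=
  (isBoundedBilinearMap_apply (𝕜 := ℝ) (E := Vec n) (F := Vec n)).continuous.measurable.comp
    ((hf.measurable_dynJac hx hu hw).prodMk hy)

end Measurability

section Ensemble

variable {μ : Measure Ω} {x : Ω → Vec n}

theorem memLp_dyn [IsFiniteMeasure μ] (hf : IsLipDyn f C) (hx : MemLp x 2 μ) (u : Vec m) :
    MemLp (fun ω => dyn f (x ω) u ω) 2 μ := by
  have hdom := ((memLp_const (1 : ℝ)).add hx.norm).const_mul (C * (1 + m * ‖u‖))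
  refine hdom.of_le ?_ (Eventually.of_forall fun ω =>
    (hf.norm_dyn_le _ _ _).trans (le_abs_self _))
  exact ((hf.measurable_dyn measurable_fst measurable_const measurable_snd).comp_aemeasurable
    (hx.1.aemeasurable.prodMk aemeasurable_id)).aestronglyMeasurable

theorem memLp_dynJac (hf : IsLipDyn f C) (hx : AEMeasurable x μ) (u : Vec m) :
    MemLp (fun ω => dynJac f (x ω) u ω) ∞ μ :=
  memLp_top_of_bound ((hf.measurable_dynJac measurable_fst measurable_const
    measurable_snd).comp_aemeasurable (hx.prodMk aemeasurable_id)).aestronglyMeasurable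
    (C * (1 + m * ‖u‖)) (Eventually.of_forall fun _ => hf.norm_dynJac_le _ _ _)

theorem coeFn_linOp (hf : IsLipDyn f C) (hx : AEMeasurable x μ) (u : Vec m)
    (ψ : Lp (Vec n) 2 μ) : linOp μ f x u ψ =ᵐ[μ] fun ω => dynJac f (x ω) u ω (ψ ω) := by
  filter_upwards [(ContinuousLinearMap.id ℝ (Vec n →L[ℝ] Vec n)).coeFn_holder (r := 2)
    (toLpClass ∞ μ (fun ω => dynJac f (x ω) u ω)) ψ, coeFn_toLpClass (hf.memLp_dynJac hx u)]
    with ω hholder hclass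
  rw [linOp, ContinuousLinearMap.holderL_apply_apply, hholder, hclass,
    ContinuousLinearMap.id_apply]

theorem memLp_dynJac_apply (hf : IsLipDyn f C) (hx : AEMeasurable x μ) (u : Vec m)
    {y : Ω → Vec n} (hy : MemLp y 2 μ) : MemLp (fun ω => dynJac f (x ω) u ω (y ω)) 2 μ :=
  MemLp.of_le_mul (c := C * (1 + m * ‖u‖)) hy
    ((isBoundedBilinearMap_apply (𝕜 := ℝ) (E := Vec n)
      (F := Vec n)).continuous.comp_aestronglyMeasurable ((hf.memLp_dynJac hx u).1.prodMk hy.1))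
    (Eventually.of_forall fun ω => (dynJac f (x ω) u ω).le_of_opNorm_le
      (hf.norm_dynJac_le _ _ _) _)

theorem linOp_toLpClass (hf : IsLipDyn f C) (hx : AEMeasurable x μ) (u : Vec m)
    {y : Ω → Vec n} (hy : MemLp y 2 μ) :
    linOp μ f x u (toLpClass 2 μ y) = toLpClass 2 μ fun ω => dynJac f (x ω) u ω (y ω) := by
  refine Lp.ext ?_
  filter_upwards [hf.coeFn_linOp hx u (toLpClass 2 μ y), coeFn_toLpClass hy,
    coeFn_toLpClass (hf.memLp_dynJac_apply hx u hy)] with ω hlin hyω hclass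
  rw [hlin, hclass, hyω]

theorem norm_linOp_le (hf : IsLipDyn f C) (hx : AEMeasurable x μ) (u : Vec m) :
    ‖linOp μ f x u‖ ≤ C * (1 + m * ‖u‖) := by
  refine ContinuousLinearMap.opNorm_le_bound _ (mul_nonneg hf.nonneg (by positivity)) fun ψ =>
    Lp.norm_le_mul_norm_of_ae_le_mul ?_
  filter_upwards [hf.coeFn_linOp hx u ψ] with ω hω
  rw [hω]
  exact (dynJac f (x ω) u ω).le_of_opNorm_le (hf.norm_dynJac_le _ _ _) _

end Ensemble

end IsLipDyn

variable {μ : Measure Ω} {x y : Ω → Vec n}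

theorem linOp_congr (f : Fin (m + 1) → Vec n → Ω → Vec n) (h : x =ᵐ[μ] y) (u : Vec m) :
    linOp μ f x u = linOp μ f y u := by
  rw [linOp, linOp, toLpClass_congr (ψ := fun ω => dynJac f (y ω) u ω)
    (h.mono fun ω hω => by simp only [hω])]

theorem dynL2_congr (f : Fin (m + 1) → Vec n → Ω → Vec n) (h : x =ᵐ[μ] y) (u : Vec m) :
    dynL2 μ f x u = dynL2 μ f y u :=
  toLpClass_congr (h.mono fun ω hω => by simp only [hω])

end LipschitzDynamics

/-! ### Trajectories of the ensemble -/

section Trajectories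

variable {Ω : Type*} {n m : ℕ}

/-- The ensemble of trajectories on `[t₀, T]` of the control `v` which starts at `ψ`; outside
`[t₀, T]` it is constant in time. -/
noncomputable def traj (f : Fin (m + 1) → Vec n → Ω → Vec n) (t₀ T : ℝ) (ψ : Ω → Vec n)
    (v : ℝ → Vec m) (t : ℝ) (ω : Ω) : Vec n :=
  picardSol (fun s y => dyn f y (v s) ω) t₀ T (ψ ω) t

/-- Controls which are Borel measurable and bounded by `R` everywhere, instead of almost
everywhere; every admissible control has such a representative. -/
structure IsBoundedControl (R : ℝ) (v : ℝ → Vec m) : Prop where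
  measurable : Measurable v
  norm_le : ∀ t, ‖v t‖ ≤ R

variable {R t₀ T : ℝ} {U : ℝ → Set (Vec m)} {v w : ℝ → Vec m}

theorem exists_isBoundedControl (hR : 0 ≤ R) {u : ℝ → Vec m}
    (hu : AEStronglyMeasurable u (volume.restrict (Icc t₀ T)))
    (huR : ∀ᵐ t ∂volume.restrict (Icc t₀ T), ‖u t‖ ≤ R) :
    ∃ v, IsBoundedControl R v ∧ ∀ᵐ t ∂volume.restrict (Icc t₀ T), u t = v t := by
  classical
  have hmk := hu.stronglyMeasurable_mk.measurable
  refine ⟨fun t => if ‖hu.mk u t‖ ≤ R then hu.mk u t else 0,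
    ⟨Measurable.ite (measurableSet_le hmk.norm measurable_const) hmk measurable_const,
      fun t => ?_⟩, ?_⟩
  · split_ifs with h
    · exact h
    · rwa [norm_zero]
  · filter_upwards [hu.ae_eq_mk, huR] with t hmk_eq htR
    rw [← hmk_eq, if_pos htR]

namespace IsBoundedControl

theorem nonneg (hv : IsBoundedControl R v) : 0 ≤ R := (norm_nonneg _).trans (hv.norm_le 0)

theorem lineMap (hv : IsBoundedControl R v) (hw : IsBoundedControl R w) {ε : ℝ}
    (hε : ε ∈ Icc (0 : ℝ) 1) : IsBoundedControl R fun t => AffineMap.lineMap (v t) (w t) ε where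
  measurable := by
    simp only [AffineMap.lineMap_apply_module']
    exact ((hw.measurable.sub hv.measurable).const_smul ε).add hv.measurable
  norm_le t := mem_closedBall_zero_iff.1 ((convex_closedBall (0 : Vec m) R).lineMap_mem
    (mem_closedBall_zero_iff.2 (hv.norm_le t)) (mem_closedBall_zero_iff.2 (hw.norm_le t)) hε)

theorem norm_sub_lineMap_le (hv : IsBoundedControl R v) (hw : IsBoundedControl R w) {ε : ℝ}
    (hε : 0 ≤ ε) (t : ℝ) : ‖v t - AffineMap.lineMap (v t) (w t) ε‖ ≤ ε * (2 * R) := by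
  rw [← dist_eq_norm, dist_left_lineMap, Real.norm_of_nonneg hε, dist_eq_norm]
  gcongr
  linarith [norm_sub_le (v t) (w t), hv.norm_le t, hw.norm_le t]

end IsBoundedControl

variable [MeasurableSpace Ω] {f : Fin (m + 1) → Vec n → Ω → Vec n} {C : ℝ}

namespace IsLipDyn

theorem mul_one_add_le (hf : IsLipDyn f C) (hv : IsBoundedControl R v) (t : ℝ) :
    C * (1 + m * ‖v t‖) ≤ C * (1 + m * R) := by
  have := hf.nonneg
  gcongr
  exact hv.norm_le t

theorem isCaratheodory (hf : IsLipDyn f C) (hv : IsBoundedControl R v) (ω : Ω) :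
    IsCaratheodory (fun t y => dyn f y (v t) ω) (C * (1 + m * R)) (C * (1 + m * R)) where
  nonneg := mul_nonneg hf.nonneg (by have := hv.nonneg; positivity)
  meas _ := (hf.measurable_dyn measurable_const hv.measurable measurable_const).stronglyMeasurable
  lip t x y := (hf.norm_dyn_sub_le x y (v t) ω).trans
    (mul_le_mul_of_nonneg_right (hf.mul_one_add_le hv t) (norm_nonneg _))
  bound t := by
    have hle := hf.norm_dyn_le 0 (v t) ω
    rw [norm_zero, add_zero, mul_one] at hle
    exact hle.trans (hf.mul_one_add_le hv t)

theorem measurable_dyn_control (hf : IsLipDyn f C) (hv : IsBoundedControl R v) (x : Vec n) :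
    Measurable fun z : ℝ × Ω => dyn f x (v z.1) z.2 :=
  hf.measurable_dyn measurable_const (hv.measurable.comp measurable_fst) measurable_snd

theorem traj_left (hf : IsLipDyn f C) (hv : IsBoundedControl R v) (hT : t₀ ≤ T) (ψ : Ω → Vec n)
    (ω : Ω) : traj f t₀ T ψ v t₀ ω = ψ ω :=
  (hf.isCaratheodory hv ω).picardSol_left hT (ψ ω)

theorem hasW11Deriv_traj (hf : IsLipDyn f C) (hv : IsBoundedControl R v) (hT : t₀ ≤ T)
    (ψ : Ω → Vec n) (ω : Ω) : HasW11Deriv t₀ T (fun t => traj f t₀ T ψ v t ω)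
      fun t => dyn f (traj f t₀ T ψ v t ω) (v t) ω :=
  (hf.isCaratheodory hv ω).hasW11Deriv_picardSol hT (ψ ω)

theorem measurable_traj (hf : IsLipDyn f C) (hv : IsBoundedControl R v) (hT : t₀ ≤ T)
    {ψ : Ω → Vec n} (hψ : Measurable ψ) :
    Measurable fun z : ℝ × Ω => traj f t₀ T ψ v z.1 z.2 :=
  measurable_picardSol (F := fun ω s y => dyn f y (v s) ω) (hf.isCaratheodory hv)
    (hf.measurable_dyn_control hv) hT hψ

theorem isAdmissible_traj (hf : IsLipDyn f C) (hv : IsBoundedControl R v) (hT : t₀ ≤ T)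
    (hvU : ∀ᵐ t ∂volume.restrict (Icc t₀ T), v t ∈ U t) (ψ : Ω → Vec n) :
    IsAdmissible f U ψ t₀ T v (traj f t₀ T ψ v) where
  control_memLp := memLp_top_of_bound hv.measurable.aestronglyMeasurable R
    (Eventually.of_forall hv.norm_le)
  control_mem := hvU
  init := hf.traj_left hv hT ψ
  arc := hf.hasW11Deriv_traj hv hT ψ

theorem traj_eq (hf : IsLipDyn f C) (hv : IsBoundedControl R v) (hT : t₀ ≤ T) {ψ : Ω → Vec n}
    {u : ℝ → Vec m} {x : ℝ → Ω → Vec n} (hx : IsAdmissible f U ψ t₀ T u x)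
    (huv : ∀ᵐ t ∂volume.restrict (Icc t₀ T), u t = v t) {t : ℝ} (ht : t ∈ Icc t₀ T) :
    traj f t₀ T ψ v t = x t := by
  funext ω
  rw [traj, ← hx.init ω]
  exact (hf.isCaratheodory hv ω).eqOn_picardSol (hx.arc ω)
    (huv.mono fun t ht => by rw [ht]) hT ht

/-! ### Dependence on the control -/

theorem exists_one_add_norm_traj_le (hf : IsLipDyn f C) (hR : 0 ≤ R) (hT : t₀ ≤ T) :
    ∃ B ≥ 0, ∀ ψ v, IsBoundedControl R v → ∀ t ω,
      1 + ‖traj f t₀ T ψ v t ω‖ ≤ B * (1 + ‖ψ ω‖) := by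
  have : 0 ≤ T - t₀ := sub_nonneg.2 hT
  have hC := hf.nonneg
  let D := C * (1 + m * R) * (T - t₀)
  let E := Real.exp (C * (1 + m * R) * (T - t₀))
  have hD : 0 ≤ D := by positivity
  refine ⟨1 + (1 + D) * E, by positivity, fun ψ v hv t ω => ?_⟩
  calc 1 + ‖traj f t₀ T ψ v t ω‖ ≤ 1 + (‖ψ ω‖ + D) * E := by
        gcongr
        exact (hf.isCaratheodory hv ω).norm_picardSol_le hT (ψ ω) t
    _ ≤ (1 + ‖ψ ω‖) + ((1 + D) * (1 + ‖ψ ω‖)) * E := by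
        have := norm_nonneg (ψ ω)
        gcongr
        · linarith
        · linarith [mul_nonneg hD this]
    _ = (1 + (1 + D) * E) * (1 + ‖ψ ω‖) := by ring

theorem exists_norm_traj_sub_le (hf : IsLipDyn f C) (hR : 0 ≤ R) (hT : t₀ ≤ T) :
    ∃ L ≥ 0, ∀ ψ v w η, IsBoundedControl R v → IsBoundedControl R w → (∀ t, ‖v t - w t‖ ≤ η) →
      ∀ t ω, ‖traj f t₀ T ψ v t ω - traj f t₀ T ψ w t ω‖ ≤ η * L * (1 + ‖ψ ω‖) ∧
        ‖dyn f (traj f t₀ T ψ v t ω) (v t) ω - dyn f (traj f t₀ T ψ w t ω) (w t) ω‖ ≤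
          η * L * (1 + ‖ψ ω‖) := by
  obtain ⟨B, hB_nonneg, hB⟩ := hf.exists_one_add_norm_traj_le hR hT
  have : 0 ≤ T - t₀ := sub_nonneg.2 hT
  have hC := hf.nonneg
  let K := C * (1 + m * R)
  let S := m * C * B
  let E := (T - t₀) * Real.exp (K * (T - t₀))
  have hK : 0 ≤ K := by positivity
  have : 0 ≤ S := by positivity
  have : 0 ≤ E := by positivity
  refine ⟨S * E + (K * (S * E) + S), by positivity, fun ψ v w η hv hw hvw t ω => ?_⟩
  have hη : 0 ≤ η := (norm_nonneg _).trans (hvw 0)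
  have hcontrol : ∀ s, ‖dyn f (traj f t₀ T ψ w s ω) (v s) ω -
      dyn f (traj f t₀ T ψ w s ω) (w s) ω‖ ≤ η * S * (1 + ‖ψ ω‖) := fun s =>
    calc _ ≤ m * ‖v s - w s‖ * (C * (1 + ‖traj f t₀ T ψ w s ω‖)) :=
          hf.norm_dyn_sub_dyn_control_le _ _ _ _
      _ ≤ m * η * (C * (B * (1 + ‖ψ ω‖))) := by
          gcongr
          exacts [hvw s, hB ψ w hw s ω]
      _ = η * S * (1 + ‖ψ ω‖) := by ring
  have hstate : ‖traj f t₀ T ψ v t ω - traj f t₀ T ψ w t ω‖ ≤ η * (S * E) * (1 + ‖ψ ω‖) := by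
    have hle := (hf.isCaratheodory hv ω).norm_solution_sub_le (hf.hasW11Deriv_traj hv hT ψ ω)
      (hf.hasW11Deriv_traj hw hT ψ ω) (by positivity) (Eventually.of_forall hcontrol)
      (max_min_mem_Icc hT t)
    rw [hf.traj_left hv hT, hf.traj_left hw hT, sub_self, norm_zero, zero_add] at hle
    simp only [traj, picardSol_max_min _ hT] at hle ⊢
    exact hle.trans_eq (by ring)
  have hvelocity : ‖dyn f (traj f t₀ T ψ v t ω) (v t) ω - dyn f (traj f t₀ T ψ w t ω) (w t) ω‖ ≤
      K * (η * (S * E) * (1 + ‖ψ ω‖)) + η * S * (1 + ‖ψ ω‖) :=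
    (norm_sub_le_norm_sub_add_norm_sub _ _ _).trans (add_le_add
      (((hf.isCaratheodory hv ω).lip t _ _).trans (mul_le_mul_of_nonneg_left hstate hK))
      (hcontrol t))
  constructor
  · refine hstate.trans ?_
    gcongr
    exact le_add_of_nonneg_right (by positivity)
  · have : 0 ≤ η * (S * E) * (1 + ‖ψ ω‖) := by positivity
    linarith

end IsLipDyn

end Trajectories

/-! ### The `L²`-valued trajectories -/

section EnsembleTrajectories

variable {Ω : Type*} [MeasurableSpace Ω] {μ : Measure Ω} {n m : ℕ}
  {f : Fin (m + 1) → Vec n → Ω → Vec n} {g : Vec n → Ω → ℝ} {C R t₀ T : ℝ} {v w : ℝ → Vec m}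
  {ψ : Ω → Vec n}

/-- The control `v` is optimal for the ensemble starting at `ψ` among the controls which are bounded
by `R` and uniformly close to `v`. -/
def IsUniformLocalMinimizer (μ : Measure Ω) (f : Fin (m + 1) → Vec n → Ω → Vec n)
    (g : Vec n → Ω → ℝ) (U : ℝ → Set (Vec m)) (ψ : Ω → Vec n) (t₀ T R : ℝ) (v : ℝ → Vec m) :
    Prop :=
  ∃ ρ > 0, ∀ w, IsBoundedControl R w → (∀ᵐ t ∂volume.restrict (Icc t₀ T), w t ∈ U t) →
    (∀ t, ‖v t - w t‖ ≤ ρ) →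
    ∫ ω, g (traj f t₀ T ψ v T ω) ω ∂μ ≤ ∫ ω, g (traj f t₀ T ψ w T ω) ω ∂μ

theorem traj_ae_eq {φ : Ω → Vec n} (h : φ =ᵐ[μ] ψ) (f : Fin (m + 1) → Vec n → Ω → Vec n)
    (t₀ T : ℝ) (v : ℝ → Vec m) (t : ℝ) : traj f t₀ T φ v t =ᵐ[μ] traj f t₀ T ψ v t := by
  filter_upwards [h] with ω hω
  rw [traj, traj, hω]

namespace IsLipDyn

variable [IsFiniteMeasure μ]

theorem memLp_traj (hf : IsLipDyn f C) (hv : IsBoundedControl R v) (hT : t₀ ≤ T)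
    (hψ : Measurable ψ) (hψ_memLp : MemLp ψ 2 μ) (t : ℝ) : MemLp (traj f t₀ T ψ v t) 2 μ :=
  IsCaratheodory.memLp_picardSol (hf.isCaratheodory hv) (hf.measurable_dyn_control hv)
    (memLp_const _) hψ hψ_memLp hT t

theorem exists_w11Norm_traj_sub_le (hf : IsLipDyn f C) (hR : 0 ≤ R) (hT : t₀ ≤ T)
    (hψ : Measurable ψ) (hψ_memLp : MemLp ψ 2 μ) :
    ∃ L ≥ 0, ∀ v w η, IsBoundedControl R v → IsBoundedControl R w → (∀ t, ‖v t - w t‖ ≤ η) →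
      w11Norm t₀ T
        (fun t => toLpClass 2 μ (traj f t₀ T ψ v t) - toLpClass 2 μ (traj f t₀ T ψ w t))
        (fun t => dynL2 μ f (traj f t₀ T ψ v t) (v t) - dynL2 μ f (traj f t₀ T ψ w t) (w t)) ≤
      η * L := by
  obtain ⟨L, hL_nonneg, hL⟩ := hf.exists_norm_traj_sub_le (n := n) hR hT
  have : 0 ≤ T - t₀ := sub_nonneg.2 hT
  let weight : Ω → ℝ := fun ω => 1 + ‖ψ ω‖
  have hweight : MemLp weight 2 μ := (memLp_const (1 : ℝ)).add hψ_memLp.norm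
  have hweight_norm : ∀ ω, ‖weight ω‖ = 1 + ‖ψ ω‖ := fun ω =>
    Real.norm_of_nonneg (add_nonneg zero_le_one (norm_nonneg (ψ ω)))
  refine ⟨2 * L * ‖toLpClass 2 μ weight‖ * (T - t₀), by positivity, fun v w η hv hw hvw => ?_⟩
  have hX := hf.memLp_traj hv hT hψ hψ_memLp
  have hY := hf.memLp_traj hw hT hψ hψ_memLp
  refine (w11Norm_le (c := η * L * ‖toLpClass 2 μ weight‖) hT (fun t => ?_)
    fun t => ?_).trans_eq (by ring)
  · exact norm_toLpClass_sub_le hweight (hX t) (hY t) (Eventually.of_forall fun ω => by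
      simpa only [hweight_norm] using (hL ψ v w η hv hw hvw t ω).1)
  · exact norm_toLpClass_sub_le hweight (hf.memLp_dyn (hX t) (v t)) (hf.memLp_dyn (hY t) (w t))
      (Eventually.of_forall fun ω => by
        simpa only [hweight_norm] using (hL ψ v w η hv hw hvw t ω).2)

variable [IsSeparable μ]

theorem hasW11Deriv_toLpClass_traj (hf : IsLipDyn f C) (hv : IsBoundedControl R v) (hT : t₀ ≤ T)
    (hψ : Measurable ψ) (hψ_memLp : MemLp ψ 2 μ) :
    HasW11Deriv t₀ T (fun t => toLpClass 2 μ (traj f t₀ T ψ v t))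
      fun t => dynL2 μ f (traj f t₀ T ψ v t) (v t) :=
  IsCaratheodory.hasW11Deriv_toLpClass_picardSol (hf.isCaratheodory hv)
    (hf.measurable_dyn_control hv) (memLp_const _) hψ hψ_memLp hT

theorem isCaratheodory_linOp (hf : IsLipDyn f C) (hv : IsBoundedControl R v) {X : ℝ → Ω → Vec n}
    (hX : Measurable fun z : ℝ × Ω => X z.1 z.2) :
    IsCaratheodory (fun t φ => linOp μ f (X t) (v t) φ) (C * (1 + m * R)) 0 := by
  have hXt : ∀ t, AEMeasurable (X t) μ := fun t => (hX.comp measurable_prodMk_left).aemeasurable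
  refine IsCaratheodory.of_opNorm_le
    (mul_nonneg hf.nonneg (by have := hv.nonneg; positivity)) (fun φ => ?_)
    fun t => (hf.norm_linOp_le (hXt t) _).trans (hf.mul_one_add_le hv t)
  have hφ : toLpClass 2 μ φ = φ := by
    rw [toLpClass_of_memLp (Lp.memLp φ), Lp.toLp_coeFn]
  have hlin : ∀ t, linOp μ f (X t) (v t) φ =
      toLpClass 2 μ fun ω => dynJac f (X t ω) (v t) ω (φ ω) := fun t => by
    rw [← hf.linOp_toLpClass (hXt t) (v t) (Lp.memLp φ), hφ]
  simp only [hlin]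
  exact stronglyMeasurable_toLpClass
    (hf.measurable_dynJac_apply hX (hv.measurable.comp measurable_fst) measurable_snd
      ((Lp.stronglyMeasurable φ).measurable.comp measurable_snd))
    fun t => hf.memLp_dynJac_apply (hXt t) (v t) (Lp.memLp φ)

end IsLipDyn

theorem IsW11LocalMinimizer.isUniformLocalMinimizer [IsFiniteMeasure μ] [IsSeparable μ]
    {U : ℝ → Set (Vec m)} {φ : Ω → Vec n} {u : ℝ → Vec m} {x : ℝ → Ω → Vec n}
    (hmin : IsW11LocalMinimizer μ f g U φ t₀ T u x) (hf : IsLipDyn f C) (hT : t₀ ≤ T)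
    (hv : IsBoundedControl R v) (huv : ∀ᵐ t ∂volume.restrict (Icc t₀ T), u t = v t)
    (hφψ : φ =ᵐ[μ] ψ) (hψ : Measurable ψ) (hψ_memLp : MemLp ψ 2 μ) :
    IsUniformLocalMinimizer μ f g U ψ t₀ T R v := by
  obtain ⟨hx, ε, hε, hmin⟩ := hmin
  obtain ⟨L, hL_nonneg, hL⟩ := hf.exists_w11Norm_traj_sub_le hv.nonneg hT hψ hψ_memLp
  refine ⟨ε / (L + 1), by positivity, fun w hw hwU hvw => ?_⟩
  have hclass : ∀ t ∈ Icc t₀ T, toLpClass 2 μ (x t) - toLpClass 2 μ (traj f t₀ T φ w t) =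
      toLpClass 2 μ (traj f t₀ T ψ v t) - toLpClass 2 μ (traj f t₀ T ψ w t) := fun t ht => by
    rw [← hf.traj_eq hv hT hx huv ht, toLpClass_congr (traj_ae_eq hφψ f t₀ T v t),
      toLpClass_congr (traj_ae_eq hφψ f t₀ T w t)]
  have hcost : ∀ z, ∫ ω, g (traj f t₀ T φ z T ω) ω ∂μ = ∫ ω, g (traj f t₀ T ψ z T ω) ω ∂μ :=
    fun z => integral_congr_ae ((traj_ae_eq hφψ f t₀ T z T).mono fun ω hω => by
      simp only [hω])
  rw [← hcost, ← hcost, hf.traj_eq hv hT hx huv (right_mem_Icc.2 hT)]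
  refine hmin w _ (hf.isAdmissible_traj hw hT hwU φ) _
    (((hf.hasW11Deriv_toLpClass_traj hv hT hψ hψ_memLp).sub
      (hf.hasW11Deriv_toLpClass_traj hw hT hψ hψ_memLp)).congr hT hclass
        (Eventually.of_forall fun _ => rfl)) ?_
  rw [w11Norm_congr hT hclass]
  refine (hL v w _ hv hw hvw).trans ?_
  rw [div_mul_eq_mul_div, div_le_iff₀ (by positivity)]
  linarith

end EnsembleTrajectories

/-! ### The first variation -/

section FirstVariation

variable {X : Type*} [NormedAddCommGroup X] [NormedSpace ℝ X]

theorem tendsto_inv_smul_sub_sub_of_hasFDerivAt {Y : Type*} [NormedAddCommGroup Y]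
    [NormedSpace ℝ Y] {f : X → Y} {f' : X →L[ℝ] Y} {x : X} {z : ℝ → X} {c : ℝ}
    (hf : HasFDerivAt f f' x) (hz : ∀ᶠ ε in 𝓝[>] 0, ‖z ε - x‖ ≤ ε * c) :
    Tendsto (fun ε => ε⁻¹ • (f (z ε) - f x - f' (z ε - x))) (𝓝[>] 0) (𝓝 0) := by
  have hbigO : (fun ε => z ε - x) =O[𝓝[>] 0] fun ε : ℝ => ε := by
    refine Asymptotics.IsBigO.of_bound c ?_
    filter_upwards [hz, self_mem_nhdsWithin] with ε hε hε_pos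
    rwa [Real.norm_of_nonneg (le_of_lt hε_pos), mul_comm]
  have hz_tendsto : Tendsto z (𝓝[>] 0) (𝓝 x) :=
    tendsto_sub_nhds_zero_iff.1 (hbigO.trans_tendsto (tendsto_id.mono_left nhdsWithin_le_nhds))
  exact ((hf.isLittleO.comp_tendsto hz_tendsto).trans_isBigO hbigO).tendsto_inv_smul_nhds_zero

/-- If `ẋ = F(t, x)` and `ż = F(t, z) + ε E(t, z)`, then this is the error with which the difference
quotient `(z - x) / ε` solves the linearized equation `ẏ = A(t) y + E(t, x)`. -/
noncomputable def linearizationError (F E : ℝ → X → X) (A : ℝ → X →L[ℝ] X) (x z : ℝ → X)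
    (ε t : ℝ) : X :=
  ε⁻¹ • (F t (z t) - F t (x t) - A t (z t - x t)) + (E t (z t) - E t (x t))

variable {F E : ℝ → X → X} {A : ℝ → X →L[ℝ] X} {K K' L M M' N a b c ε t : ℝ} {x y z : ℝ → X}

theorem hasW11Deriv_inv_smul_sub_sub (hε : ε ≠ 0) (hx : HasW11Deriv a b x fun t => F t (x t))
    (hz : HasW11Deriv a b z fun t => F t (z t) + ε • E t (z t))
    (hy : HasW11Deriv a b y fun t => A t (y t) + E t (x t)) :
    HasW11Deriv a b (fun t => ε⁻¹ • (z t - x t) - y t)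
      fun t => A t (ε⁻¹ • (z t - x t) - y t) + linearizationError F E A x z ε t := by
  convert ((hz.sub hx).const_smul ε⁻¹).sub hy using 2 with t
  rw [linearizationError, map_sub, map_smul]
  simp only [smul_sub, smul_add, inv_smul_smul₀ hε]
  abel

theorem norm_linearizationError_le (hF : IsCaratheodory F K M) (hE : IsCaratheodory E K' M')
    (hA : IsCaratheodory (fun t y => A t y) L N) (hε : ε ∈ Ioc (0 : ℝ) 1) (hc : 0 ≤ c)
    (hz : ‖z t - x t‖ ≤ ε * c) : ‖linearizationError F E A x z ε t‖ ≤ (K + L + K') * c := by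
  have hquot : ‖ε⁻¹ • (F t (z t) - F t (x t) - A t (z t - x t))‖ ≤ (K + L) * c := by
    rw [norm_smul, norm_inv, Real.norm_of_nonneg hε.1.le, inv_mul_le_iff₀ hε.1]
    calc _ ≤ K * ‖z t - x t‖ + L * ‖z t - x t‖ :=
          norm_sub_le_of_le (hF.lip t _ _) ((A t).le_of_opNorm_le (hA.opNorm_le t) _)
      _ ≤ (K + L) * (ε * c) := by
          rw [← add_mul]
          exact mul_le_mul_of_nonneg_left hz (add_nonneg hF.nonneg hA.nonneg)
      _ = ε * ((K + L) * c) := by ring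
  have hpert : ‖E t (z t) - E t (x t)‖ ≤ K' * c :=
    (hE.lip t _ _).trans (mul_le_mul_of_nonneg_left
      (hz.trans (mul_le_of_le_one_left hc hε.2)) hE.nonneg)
  rw [add_mul]
  exact norm_add_le_of_le hquot hpert

theorem tendsto_linearizationError {z : ℝ → ℝ → X} (hE : IsCaratheodory E K' M')
    (hFA : HasFDerivAt (F t) (A t) (x t)) (hz : ∀ᶠ ε in 𝓝[>] 0, ‖z ε t - x t‖ ≤ ε * c) :
    Tendsto (fun ε => linearizationError F E A x (z ε) ε t) (𝓝[>] 0) (𝓝 0) := by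
  have hε : Tendsto (fun ε : ℝ => ε * c) (𝓝[>] 0) (𝓝 0) :=
    ((continuous_mul_const c).tendsto' 0 0 (zero_mul c)).mono_left nhdsWithin_le_nhds
  have hz_tendsto : Tendsto (fun ε => z ε t) (𝓝[>] 0) (𝓝 (x t)) :=
    tendsto_sub_nhds_zero_iff.1 (squeeze_zero_norm' hz hε)
  have hpert : Tendsto (fun ε => E t (z ε t)) (𝓝[>] 0) (𝓝 (E t (x t))) :=
    ((hE.continuous t).tendsto (x t)).comp hz_tendsto
  simpa only [linearizationError, add_zero] using
    (tendsto_inv_smul_sub_sub_of_hasFDerivAt (z := fun ε => z ε t) hFA hz).add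
      (tendsto_sub_nhds_zero_iff.2 hpert)

variable [SecondCountableTopology X]

theorem intervalIntegrable_linearizationError (hF : IsCaratheodory F K M)
    (hE : IsCaratheodory E K' M') (hA : IsCaratheodory (fun t y => A t y) L N)
    (hx : ContinuousOn x (uIcc a b)) (hz : ContinuousOn z (uIcc a b)) (ε : ℝ) :
    IntervalIntegrable (linearizationError F E A x z ε) volume a b :=
  ((((hF.intervalIntegrable hz).sub (hF.intervalIntegrable hx)).sub
    (hA.intervalIntegrable (hz.sub hx))).smul ε⁻¹).add
    ((hE.intervalIntegrable hz).sub (hE.intervalIntegrable hx))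

theorem tendsto_integral_norm_linearizationError {z : ℝ → ℝ → X} (hF : IsCaratheodory F K M)
    (hE : IsCaratheodory E K' M') (hA : IsCaratheodory (fun t y => A t y) L N) (hab : a ≤ b)
    (hx : ContinuousOn x (uIcc a b)) (hz : ∀ ε ∈ Ioc (0 : ℝ) 1, ContinuousOn (z ε) (uIcc a b))
    (hzx : ∀ ε ∈ Ioc (0 : ℝ) 1, ∀ t ∈ Icc a b, ‖z ε t - x t‖ ≤ ε * c)
    (hFA : ∀ᵐ t ∂volume.restrict (Icc a b), HasFDerivAt (F t) (A t) (x t)) :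
    Tendsto (fun ε => ∫ t in a..b, ‖linearizationError F E A x (z ε) ε t‖) (𝓝[>] 0) (𝓝 0) := by
  have hmem : ∀ᶠ ε : ℝ in 𝓝[>] 0, ε ∈ Ioc (0 : ℝ) 1 := Ioc_mem_nhdsGT one_pos
  have hc : 0 ≤ c := by
    simpa using (norm_nonneg _).trans (hzx 1 ⟨one_pos, le_rfl⟩ a (left_mem_Icc.2 hab))
  have hIoc : ∀ t ∈ uIoc a b, t ∈ Icc a b := fun t ht =>
    Ioc_subset_Icc_self (by rwa [uIoc_of_le hab] at ht)
  suffices Tendsto (fun ε => ∫ t in a..b, ‖linearizationError F E A x (z ε) ε t‖) (𝓝[>] 0)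
      (𝓝 (∫ _ in a..b, (0 : ℝ))) by rwa [intervalIntegral.integral_zero] at this
  refine intervalIntegral.tendsto_integral_filter_of_dominated_convergence
    (fun _ => (K + L + K') * c) ?_ ?_ intervalIntegrable_const ?_
  · filter_upwards [hmem] with ε hε
    exact (intervalIntegrable_linearizationError hF hE hA hx (hz ε hε)
      ε).norm.aestronglyMeasurable_restrict_uIoc
  · filter_upwards [hmem] with ε hε
    exact Eventually.of_forall fun t ht => by
      rw [norm_norm]
      exact norm_linearizationError_le hF hE hA hε hc (hzx ε hε t (hIoc t ht))
  · filter_upwards [(ae_restrict_iff' measurableSet_Icc).1 hFA] with t ht htab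
    exact tendsto_zero_iff_norm_tendsto_zero.1 (tendsto_linearizationError hE (ht (hIoc t htab))
      (hmem.mono fun ε hε => hzx ε hε t (hIoc t htab)))

theorem tendsto_inv_smul_sub_of_hasW11Deriv {z : ℝ → ℝ → X} (hF : IsCaratheodory F K M)
    (hE : IsCaratheodory E K' M') (hA : IsCaratheodory (fun t y => A t y) L N) (hab : a ≤ b)
    (hx : HasW11Deriv a b x fun t => F t (x t))
    (hz : ∀ ε ∈ Ioc (0 : ℝ) 1, HasW11Deriv a b (z ε) fun t => F t (z ε t) + ε • E t (z ε t))
    (hza : ∀ ε ∈ Ioc (0 : ℝ) 1, z ε a = x a)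
    (hzx : ∀ ε ∈ Ioc (0 : ℝ) 1, ∀ t ∈ Icc a b, ‖z ε t - x t‖ ≤ ε * c)
    (hy : HasW11Deriv a b y fun t => A t (y t) + E t (x t)) (hya : y a = 0)
    (hFA : ∀ᵐ t ∂volume.restrict (Icc a b), HasFDerivAt (F t) (A t) (x t)) :
    Tendsto (fun ε => ε⁻¹ • (z ε b - x b)) (𝓝[>] 0) (𝓝 (y b)) := by
  have hx_cont := hx.continuousOn
  have hz_cont := fun ε hε => (hz ε hε).continuousOn
  rw [← uIcc_of_le hab] at hx_cont hz_cont
  have herror := (tendsto_integral_norm_linearizationError hF hE hA hab hx_cont hz_cont hzx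
    hFA).mul_const (Real.exp (L * (b - a)))
  rw [zero_mul] at herror
  refine tendsto_sub_nhds_zero_iff.1 (squeeze_zero_norm' ?_ herror)
  filter_upwards [Ioc_mem_nhdsGT one_pos] with ε hε
  have hgronwall := (hasW11Deriv_inv_smul_sub_sub hε.1.ne' hx (hz ε hε) hy).norm_le hA.nonneg
    (intervalIntegrable_linearizationError hF hE hA hx_cont (hz_cont ε hε) ε).norm
    (fun _ => norm_nonneg _) (Eventually.of_forall fun t =>
      norm_add_le_of_le ((A t).le_of_opNorm_le (hA.opNorm_le t) _) le_rfl) (right_mem_Icc.2 hab)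
  rwa [hza ε hε, hya, sub_self, smul_zero, sub_zero, norm_zero, zero_add] at hgronwall

end FirstVariation

section EnsembleVariation

variable {Ω : Type*} {n m : ℕ}

/-- The right-hand side of the first variation of `ẋ = f(x, v, ω)` along `X`, in the direction of
the control `w`. -/
noncomputable def variationField (f : Fin (m + 1) → Vec n → Ω → Vec n) (X : ℝ → Ω → Vec n)
    (v w : ℝ → Vec m) (ω : Ω) (t : ℝ) (y : Vec n) : Vec n :=
  dynJac f (X t ω) (v t) ω y + (dyn f (X t ω) (w t) ω - dyn f (X t ω) (v t) ω)

/-- The first variation on `[t₀, T]` of the trajectories of `v`, in the direction of the control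
`w`; outside `[t₀, T]` it is constant in time. -/
noncomputable def variation (f : Fin (m + 1) → Vec n → Ω → Vec n) (t₀ T : ℝ) (ψ : Ω → Vec n)
    (v w : ℝ → Vec m) (t : ℝ) (ω : Ω) : Vec n :=
  picardSol (variationField f (traj f t₀ T ψ v) v w ω) t₀ T 0 t

variable [MeasurableSpace Ω] {f : Fin (m + 1) → Vec n → Ω → Vec n} {C R t₀ T : ℝ}
  {v w : ℝ → Vec m} {ψ : Ω → Vec n}

theorem IsCaratheodory.sub {X : Type*} [NormedAddCommGroup X] {F E : ℝ → X → X} {K K' M M' : ℝ}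
    (hF : IsCaratheodory F K M) (hE : IsCaratheodory E K' M') :
    IsCaratheodory (fun t y => F t y - E t y) (K + K') (M + M') where
  nonneg := add_nonneg hF.nonneg hE.nonneg
  meas x := (hF.meas x).sub (hE.meas x)
  lip t x y := by
    rw [sub_sub_sub_comm, add_mul]
    exact norm_sub_le_of_le (hF.lip t x y) (hE.lip t x y)
  bound t := norm_sub_le_of_le (hF.bound t) (hE.bound t)

namespace IsLipDyn

theorem isCaratheodory_dynJac (hf : IsLipDyn f C) (hv : IsBoundedControl R v) {X : ℝ → Vec n}
    (hX : Measurable X) (ω : Ω) :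
    IsCaratheodory (fun t y => dynJac f (X t) (v t) ω y) (C * (1 + m * R)) 0 :=
  IsCaratheodory.of_opNorm_le (mul_nonneg hf.nonneg (by have := hv.nonneg; positivity))
    (fun _ => (hf.measurable_dynJac_apply hX hv.measurable measurable_const
      measurable_const).stronglyMeasurable)
    fun t => (hf.norm_dynJac_le _ _ _).trans (hf.mul_one_add_le hv t)

theorem measurable_variationField (hf : IsLipDyn f C) (hv : IsBoundedControl R v)
    (hw : IsBoundedControl R w) {X : ℝ → Ω → Vec n} (hX : Measurable fun z : ℝ × Ω => X z.1 z.2)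
    (y : Vec n) : Measurable fun z : ℝ × Ω => variationField f X v w z.2 z.1 y :=
  (hf.measurable_dynJac_apply hX (hv.measurable.comp measurable_fst) measurable_snd
    measurable_const).add
      ((hf.measurable_dyn hX (hw.measurable.comp measurable_fst) measurable_snd).sub
        (hf.measurable_dyn hX (hv.measurable.comp measurable_fst) measurable_snd))

theorem exists_isCaratheodory_variationField (hf : IsLipDyn f C) (hv : IsBoundedControl R v)
    (hw : IsBoundedControl R w) (hT : t₀ ≤ T) (hψ : Measurable ψ) :
    ∃ D, ∀ ω, IsCaratheodory (variationField f (traj f t₀ T ψ v) v w ω) (C * (1 + m * R))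
      (D * (1 + ‖ψ ω‖)) := by
  obtain ⟨B, -, hB⟩ := hf.exists_one_add_norm_traj_le (n := n) hv.nonneg hT
  have hX := hf.measurable_traj hv hT hψ
  have hK : 0 ≤ C * (1 + m * R) := mul_nonneg hf.nonneg (by have := hv.nonneg; positivity)
  refine ⟨C * (1 + m * R) * B + C * (1 + m * R) * B, fun ω => ⟨hK, fun y => ?_, fun t y z => ?_,
    fun t => ?_⟩⟩
  · exact ((hf.measurable_variationField hv hw hX y).comp
      measurable_prodMk_right).stronglyMeasurable
  · rw [variationField, variationField, add_sub_add_right_eq_sub]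
    exact (hf.isCaratheodory_dynJac hv (hX.comp measurable_prodMk_right) ω).lip t y z
  · have hdyn : ∀ u, IsBoundedControl R u →
        ‖dyn f (traj f t₀ T ψ v t ω) (u t) ω‖ ≤ C * (1 + m * R) * (B * (1 + ‖ψ ω‖)) := fun u hu =>
      (hf.norm_dyn_le _ _ _).trans
        (mul_le_mul (hf.mul_one_add_le hu t) (hB ψ v hv t ω) (by positivity) hK)
    rw [variationField, map_zero, zero_add]
    exact (norm_sub_le_of_le (hdyn w hw) (hdyn v hv)).trans_eq (by ring)

theorem variation_left (hf : IsLipDyn f C) (hv : IsBoundedControl R v)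
    (hw : IsBoundedControl R w) (hT : t₀ ≤ T) (hψ : Measurable ψ) :
    variation f t₀ T ψ v w t₀ = 0 := by
  obtain ⟨D, hD⟩ := hf.exists_isCaratheodory_variationField hv hw hT hψ
  funext ω
  exact (hD ω).picardSol_left hT 0

theorem tendsto_variation (hf : IsLipDyn f C) (hv : IsBoundedControl R v)
    (hw : IsBoundedControl R w) (hT : t₀ ≤ T) (hψ : Measurable ψ) {ω : Ω}
    (hdiff : ∀ᵐ t ∂volume.restrict (Icc t₀ T),
      DifferentiableAt ℝ (fun y => dyn f y (v t) ω) (traj f t₀ T ψ v t ω)) :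
    Tendsto (fun ε : ℝ => ε⁻¹ • (traj f t₀ T ψ (fun t => AffineMap.lineMap (v t) (w t) ε) T ω -
      traj f t₀ T ψ v T ω)) (𝓝[>] 0) (𝓝 (variation f t₀ T ψ v w T ω)) := by
  obtain ⟨L, -, hL⟩ := hf.exists_norm_traj_sub_le (n := n) hv.nonneg hT
  obtain ⟨D, hD⟩ := hf.exists_isCaratheodory_variationField hv hw hT hψ
  have hline : ∀ ε ∈ Ioc (0 : ℝ) 1, IsBoundedControl R fun t => AffineMap.lineMap (v t) (w t) ε :=
    fun ε hε => hv.lineMap hw (Ioc_subset_Icc_self hε)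
  have hX : Measurable fun t => traj f t₀ T ψ v t ω :=
    (hf.measurable_traj hv hT hψ).of_uncurry_right
  have hvar : HasW11Deriv t₀ T (fun t => variation f t₀ T ψ v w t ω) fun t =>
      variationField f (traj f t₀ T ψ v) v w ω t (variation f t₀ T ψ v w t ω) :=
    (hD ω).hasW11Deriv_picardSol hT 0
  refine tendsto_inv_smul_sub_of_hasW11Deriv (c := 2 * R * L * (1 + ‖ψ ω‖))
    (F := fun t y => dyn f y (v t) ω) (E := fun t y => dyn f y (w t) ω - dyn f y (v t) ω)
    (A := fun t => dynJac f (traj f t₀ T ψ v t ω) (v t) ω)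
    (x := fun t => traj f t₀ T ψ v t ω) (y := fun t => variation f t₀ T ψ v w t ω)
    (z := fun ε t => traj f t₀ T ψ (fun t => AffineMap.lineMap (v t) (w t) ε) t ω)
    (hf.isCaratheodory hv ω) ((hf.isCaratheodory hw ω).sub (hf.isCaratheodory hv ω))
    (hf.isCaratheodory_dynJac hv hX ω) hT (hf.hasW11Deriv_traj hv hT ψ ω) (fun ε hε => ?_)
    (fun ε hε => ?_) (fun ε hε t _ => ?_) hvar
    ((hD ω).picardSol_left hT 0) (hdiff.mono fun t ht => ht.hasFDerivAt)
  · simpa only [dyn_lineMap] using hf.hasW11Deriv_traj (hline ε hε) hT ψ ω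
  · rw [hf.traj_left (hline ε hε) hT, hf.traj_left hv hT]
  · rw [norm_sub_rev]
    exact (hL ψ v _ _ hv (hline ε hε) (hv.norm_sub_lineMap_le hw hε.1.le) t ω).1.trans_eq (by ring)

section SquareIntegrable

variable {μ : Measure Ω} [IsFiniteMeasure μ]

theorem memLp_variation (hf : IsLipDyn f C) (hv : IsBoundedControl R v)
    (hw : IsBoundedControl R w) (hT : t₀ ≤ T) (hψ : Measurable ψ) (hψ_memLp : MemLp ψ 2 μ)
    (t : ℝ) : MemLp (variation f t₀ T ψ v w t) 2 μ := by
  obtain ⟨D, hD⟩ := hf.exists_isCaratheodory_variationField hv hw hT hψ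
  exact IsCaratheodory.memLp_picardSol hD
    (hf.measurable_variationField hv hw (hf.measurable_traj hv hT hψ))
    (((memLp_const (1 : ℝ)).add hψ_memLp.norm).const_mul D) measurable_const MemLp.zero' hT t

variable [IsSeparable μ]

theorem hasW11Deriv_toLpClass_variation (hf : IsLipDyn f C) (hv : IsBoundedControl R v)
    (hw : IsBoundedControl R w) (hT : t₀ ≤ T) (hψ : Measurable ψ) (hψ_memLp : MemLp ψ 2 μ) :
    HasW11Deriv t₀ T (fun t => toLpClass 2 μ (variation f t₀ T ψ v w t)) fun t =>
      linOp μ f (traj f t₀ T ψ v t) (v t) (toLpClass 2 μ (variation f t₀ T ψ v w t)) +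
        (dynL2 μ f (traj f t₀ T ψ v t) (w t) - dynL2 μ f (traj f t₀ T ψ v t) (v t)) := by
  obtain ⟨D, hD⟩ := hf.exists_isCaratheodory_variationField hv hw hT hψ
  have hX := hf.measurable_traj hv hT hψ
  refine (IsCaratheodory.hasW11Deriv_toLpClass_picardSol hD (hf.measurable_variationField hv hw hX)
    (((memLp_const (1 : ℝ)).add hψ_memLp.norm).const_mul D) measurable_const MemLp.zero' hT).congr
      hT (fun _ _ => rfl) (Eventually.of_forall fun t => ?_)
  have hXt := hf.memLp_traj hv hT hψ hψ_memLp t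
  have hYt := hf.memLp_variation hv hw hT hψ hψ_memLp t
  have hdyn := hf.memLp_dyn hXt
  rw [hf.linOp_toLpClass hXt.1.aemeasurable _ hYt, dynL2, dynL2,
    toLpClass_sub (hdyn (w t)) (hdyn (v t))]
  exact toLpClass_add (hf.memLp_dynJac_apply hXt.1.aemeasurable (v t) hYt)
    ((hdyn (w t)).sub (hdyn (v t)))

end SquareIntegrable

end IsLipDyn

end EnsembleVariation

/-! ### The averaged cost -/

section Cost

open scoped NNReal

variable {Ω E : Type*} [MeasurableSpace Ω] {μ : Measure Ω} [NormedAddCommGroup E]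

/-- Integrands `g` which are `k`-Lipschitz in the state and for which the averaged cost
`∫ g(y(ω), ω) dμ(ω)` of every integrable `y` is finite. -/
structure IsLipCost (μ : Measure Ω) (g : E → Ω → ℝ) (k : ℝ≥0) : Prop where
  meas : ∀ x, Measurable (g x)
  lip : ∀ ω, LipschitzWith k fun x => g x ω
  integrable : Integrable (g 0) μ

variable {g : E → Ω → ℝ} {k : ℝ≥0} {x y : Ω → E} [MeasurableSpace E] [BorelSpace E]

theorem H0.exists_isLipCost [IsFiniteMeasure μ] {n m : ℕ} {f : Fin (m + 1) → Vec n → Ω → Vec n}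
    {g : Vec n → Ω → ℝ} {U : ℝ → Set (Vec m)} {t₀ T : ℝ} (h0 : H0 f g U t₀ T) :
    ∃ k, IsLipCost μ g k := by
  obtain ⟨k, -, hk⟩ := h0.g_lipschitz
  obtain ⟨M, -, hM⟩ := h0.g_bounded
  have hmeas : ∀ x, Measurable (g x) := fun x => h0.g_measurable.comp measurable_prodMk_left
  refine ⟨k.toNNReal, hmeas, fun ω => LipschitzWith.of_dist_le' fun x y => ?_,
    .of_bound (hmeas 0).aestronglyMeasurable M (Eventually.of_forall (hM 0))⟩
  rw [dist_eq_norm, dist_eq_norm]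
  exact hk x y ω

namespace IsLipCost

theorem integrable_comp [SecondCountableTopology E] (hg : IsLipCost μ g k)
    (hx : Integrable x μ) : Integrable (fun ω => g (x ω) ω) μ := by
  have hmeas : Measurable fun z : E × Ω => g z.1 z.2 :=
    measurable_uncurry_of_continuous_of_measurable (fun ω => (hg.lip ω).continuous) hg.meas
  refine (hg.integrable.norm.add (hx.norm.const_mul k)).mono'
    (hmeas.comp_aemeasurable (hx.1.aemeasurable.prodMk aemeasurable_id)).aestronglyMeasurable
    (Eventually.of_forall fun ω => ?_)
  have hle := (hg.lip ω).norm_sub_le (x ω) 0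
  rw [sub_zero] at hle
  exact (norm_le_norm_add_norm_sub' _ _).trans (add_le_add_right hle _)

variable [InnerProductSpace ℝ E] [CompleteSpace E]

theorem memLp_gradient [FiniteDimensional ℝ E] [IsFiniteMeasure μ] (hg : IsLipCost μ g k)
    (hx : AEMeasurable x μ) : MemLp (fun ω => gradient (fun z => g z ω) (x ω)) 2 μ := by
  refine MemLp.of_bound ?_ k (Eventually.of_forall fun ω => ?_)
  · have hfderiv : AEMeasurable (fun ω => fderiv ℝ (fun z => g z ω) (x ω)) μ :=
      (measurable_fderiv_of_continuous_of_measurable (fun ω => (hg.lip ω).continuous)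
        hg.meas).comp_aemeasurable (aemeasurable_id.prodMk hx)
    exact ((InnerProductSpace.toDual ℝ E).symm.continuous.measurable.comp_aemeasurable
      hfderiv).aestronglyMeasurable
  · rw [gradient, LinearIsometryEquiv.norm_map]
    exact norm_fderiv_le_of_lipschitz ℝ (hg.lip ω)

theorem tendsto_inv_mul_integral_sub [SecondCountableTopology E] (hg : IsLipCost μ g k)
    {z : ℝ → Ω → E} {h : Ω → ℝ} (hx : Integrable x μ)
    (hz : ∀ᶠ ε in 𝓝[>] 0, Integrable (z ε) μ) (hh : Integrable h μ)
    (hzx : ∀ᶠ ε in 𝓝[>] 0, ∀ᵐ ω ∂μ, ‖z ε ω - x ω‖ ≤ ε * h ω)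
    (hlim : ∀ᵐ ω ∂μ, Tendsto (fun ε : ℝ => ε⁻¹ • (z ε ω - x ω)) (𝓝[>] 0) (𝓝 (y ω)))
    (hdiff : ∀ᵐ ω ∂μ, DifferentiableAt ℝ (fun y => g y ω) (x ω)) :
    Tendsto (fun ε : ℝ => ε⁻¹ * (∫ ω, g (z ε ω) ω ∂μ - ∫ ω, g (x ω) ω ∂μ)) (𝓝[>] 0)
      (𝓝 (∫ ω, inner ℝ (gradient (fun y => g y ω) (x ω)) (y ω) ∂μ)) := by
  have hquotient : Tendsto (fun ε : ℝ => ∫ ω, ε⁻¹ * (g (z ε ω) ω - g (x ω) ω) ∂μ) (𝓝[>] 0)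
      (𝓝 (∫ ω, inner ℝ (gradient (fun y => g y ω) (x ω)) (y ω) ∂μ)) := by
    refine tendsto_integral_filter_of_dominated_convergence (fun ω => k * h ω) ?_ ?_
      (hh.const_mul k) ?_
    · filter_upwards [hz] with ε hε
      exact (((hg.integrable_comp hε).sub (hg.integrable_comp hx)).const_mul _).1
    · filter_upwards [hzx, self_mem_nhdsWithin] with ε hε hε_pos
      filter_upwards [hε] with ω hω
      rw [norm_mul, norm_inv, Real.norm_of_nonneg (le_of_lt hε_pos), inv_mul_le_iff₀ hε_pos,
        mul_left_comm]
      exact ((hg.lip ω).norm_sub_le _ _).trans (mul_le_mul_of_nonneg_left hω k.2)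
    · filter_upwards [hlim, hdiff] with ω hω hdω
      have hsub : Tendsto (fun ε : ℝ => z ε ω - x ω) (𝓝[>] 0) (𝓝 0) := by
        have hε : Tendsto (fun ε : ℝ => ε) (𝓝[>] 0) (𝓝 0) := nhdsWithin_le_nhds
        refine (zero_smul ℝ (y ω) ▸ hε.smul hω).congr' ?_
        filter_upwards [self_mem_nhdsWithin] with ε hε_pos
        exact smul_inv_smul₀ (ne_of_gt hε_pos) _
      rw [gradient, InnerProductSpace.toDual_symm_apply]
      simpa only [add_sub_cancel, smul_eq_mul] using
        (hasFDerivWithinAt_univ.2 hdω.hasFDerivAt).lim hsub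
          (Eventually.of_forall fun _ => mem_univ _) hω
  refine hquotient.congr' ?_
  filter_upwards [hz] with ε hε
  rw [integral_const_mul, integral_sub (hg.integrable_comp hε) (hg.integrable_comp hx)]

end IsLipCost

end Cost

/-! ### The maximum principle for bounded controls -/

section MaximumPrinciple

open scoped NNReal

variable {Ω : Type*} [MeasurableSpace Ω] {μ : Measure Ω} {n m : ℕ}
  {f : Fin (m + 1) → Vec n → Ω → Vec n} {g : Vec n → Ω → ℝ} {U : ℝ → Set (Vec m)}
  {C R t₀ T : ℝ} {k : ℝ≥0} {v w : ℝ → Vec m} {ψ : Ω → Vec n}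

theorem ae_forall_le_of_forall_isBoundedControl {Φ : ℝ × Vec m → ℝ} (hΦ : Measurable Φ)
    (hU_graph : MeasurableSet
      {z : NullMeasurableSpace ℝ (volume : Measure ℝ) × Vec m | z.1 ∈ Icc t₀ T ∧ z.2 ∈ U z.1})
    (hUR : ∀ t ∈ Icc t₀ T, ∀ c ∈ U t, ‖c‖ ≤ R)
    (hv : IsBoundedControl R v) (hvU : ∀ᵐ t ∂volume.restrict (Icc t₀ T), v t ∈ U t)
    (hint : ∀ w, IsBoundedControl R w →
      Integrable (fun t => Φ (t, w t)) (volume.restrict (Icc t₀ T)))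
    (hle : ∀ w, IsBoundedControl R w → (∀ᵐ t ∂volume.restrict (Icc t₀ T), w t ∈ U t) →
      ∫ t in Icc t₀ T, Φ (t, w t) ≤ ∫ t in Icc t₀ T, Φ (t, v t)) :
    ∀ᵐ t ∂volume.restrict (Icc t₀ T), ∀ c ∈ U t, Φ (t, c) ≤ Φ (t, v t) := by
  obtain ⟨B, hB, hUB⟩ := exists_measurableSet_of_nullMeasurable_prod hU_graph
  replace hUB : ∀ᵐ t ∂volume.restrict (Icc t₀ T), ∀ c, c ∈ U t ↔ (t, c) ∈ B := by
    filter_upwards [ae_restrict_of_ae hUB, ae_restrict_mem measurableSet_Icc] with t htB ht c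
    exact (and_iff_right ht).symm.trans (htB c)
  have hbounded : ∀ w, Measurable w → (∀ᵐ t ∂volume.restrict (Icc t₀ T), (t, w t) ∈ B) →
      ∃ z, IsBoundedControl R z ∧ (∀ᵐ t ∂volume.restrict (Icc t₀ T), z t ∈ U t) ∧
        (fun t => Φ (t, w t)) =ᵐ[volume.restrict (Icc t₀ T)] fun t => Φ (t, z t) := by
    intro w hw hwB
    obtain ⟨z, hz, hwz⟩ := exists_isBoundedControl hv.nonneg hw.aestronglyMeasurable (by
      filter_upwards [hwB, hUB, ae_restrict_mem measurableSet_Icc] with t htB htU ht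
      exact hUR t ht _ ((htU _).2 htB))
    refine ⟨z, hz, ?_, hwz.mono fun t ht => by simp only [ht]⟩
    filter_upwards [hwB, hUB, hwz] with t htB htU ht
    exact ht ▸ (htU _).2 htB
  have hmax := ae_forall_le_of_forall_integral_le hB hΦ hv.measurable
    (by filter_upwards [hvU, hUB] with t htv htU using (htU _).1 htv)
    (fun w hw hwB => ?_) fun w hw hwB => ?_
  · filter_upwards [hmax, hUB] with t ht htU c hc
    exact ht c ((htU c).1 hc)
  · obtain ⟨z, hz, -, hwz⟩ := hbounded w hw hwB
    exact (hint z hz).congr hwz.symm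
  · obtain ⟨z, hz, hzU, hwz⟩ := hbounded w hw hwB
    exact (integral_congr_ae hwz).trans_le (hle z hz hzU)

namespace IsLipDyn

variable [IsFiniteMeasure μ] [IsSeparable μ] {p : ℝ → Lp (Vec n) 2 μ}

theorem integrable_inner_dynL2 (hf : IsLipDyn f C) (hT : t₀ ≤ T) (hv : IsBoundedControl R v)
    (hw : IsBoundedControl R w) (hψ : Measurable ψ) (hψ_memLp : MemLp ψ 2 μ) (hp : Continuous p) :
    Integrable (fun t => (inner ℝ (p t) (dynL2 μ f (traj f t₀ T ψ v t) (w t)) : ℝ))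
      (volume.restrict (Icc t₀ T)) := by
  obtain ⟨B, -, hB⟩ := hf.exists_one_add_norm_traj_le (n := n) hv.nonneg hT
  obtain ⟨c, hc⟩ := isCompact_Icc.exists_bound_of_continuousOn (hp.continuousOn (s := Icc t₀ T))
  have hdyn : IntervalIntegrable (fun t => dynL2 μ f (traj f t₀ T ψ v t) (w t)) volume t₀ T := by
    refine intervalIntegrable_toLpClass
      (((memLp_const (1 : ℝ)).add hψ_memLp.norm).const_mul (C * (1 + m * R) * B))
      (hf.measurable_dyn (hf.measurable_traj hv hT hψ) (hw.measurable.comp measurable_fst)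
        measurable_snd) (fun t ω => ?_) _ _
    refine (hf.norm_dyn_le _ _ _).trans ((mul_le_mul (hf.mul_one_add_le hw t) (hB ψ v hv t ω)
      (by positivity) ?_).trans_eq (mul_assoc _ _ _).symm)
    exact mul_nonneg hf.nonneg (by have := hv.nonneg; positivity)
  have hdyn_Icc : IntegrableOn (fun t => dynL2 μ f (traj f t₀ T ψ v t) (w t)) (Icc t₀ T) :=
    (intervalIntegrable_iff_integrableOn_Icc_of_le hT).1 hdyn
  refine (hdyn_Icc.norm.const_mul c).mono' (hp.aestronglyMeasurable.inner hdyn_Icc.1) ?_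
  filter_upwards [ae_restrict_mem measurableSet_Icc] with t ht
  exact (norm_inner_le_norm _ _).trans (mul_le_mul_of_nonneg_right (hc t ht) (norm_nonneg _))

theorem measurable_inner_dynL2 (hf : IsLipDyn f C) (hT : t₀ ≤ T) (hv : IsBoundedControl R v)
    (hψ : Measurable ψ) (hψ_memLp : MemLp ψ 2 μ) (hp : Continuous p) :
    Measurable fun z : ℝ × Vec m =>
      (inner ℝ (p z.1) (dynL2 μ f (traj f t₀ T ψ v z.1) z.2) : ℝ) := by
  have hX : Measurable fun y : (ℝ × Vec m) × Ω => traj f t₀ T ψ v y.1.1 y.2 :=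
    (hf.measurable_traj hv hT hψ).comp (f := fun y : (ℝ × Vec m) × Ω => (y.1.1, y.2))
      ((measurable_fst.comp measurable_fst).prodMk measurable_snd)
  have hdyn : StronglyMeasurable fun z : ℝ × Vec m => dynL2 μ f (traj f t₀ T ψ v z.1) z.2 :=
    stronglyMeasurable_toLpClass
      (Z := fun (z : ℝ × Vec m) ω => dyn f (traj f t₀ T ψ v z.1 ω) z.2 ω)
      (hf.measurable_dyn hX (measurable_snd.comp measurable_fst) measurable_snd)
      fun z => hf.memLp_dyn (hf.memLp_traj hv hT hψ hψ_memLp z.1) z.2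
  have hp_meas : StronglyMeasurable fun z : ℝ × Vec m => p z.1 :=
    hp.stronglyMeasurable.comp_measurable measurable_fst
  exact (continuous_inner.comp_stronglyMeasurable (hp_meas.prodMk hdyn)).measurable

end IsLipDyn

namespace IsUniformLocalMinimizer

theorem eventually_integral_le (hmin : IsUniformLocalMinimizer μ f g U ψ t₀ T R v)
    (hU : ∀ᵐ t ∂volume.restrict (Icc t₀ T), Convex ℝ (U t))
    (hv : IsBoundedControl R v) (hvU : ∀ᵐ t ∂volume.restrict (Icc t₀ T), v t ∈ U t)
    (hw : IsBoundedControl R w) (hwU : ∀ᵐ t ∂volume.restrict (Icc t₀ T), w t ∈ U t) :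
    ∀ᶠ ε in 𝓝[>] (0 : ℝ), ∫ ω, g (traj f t₀ T ψ v T ω) ω ∂μ ≤
      ∫ ω, g (traj f t₀ T ψ (fun t => AffineMap.lineMap (v t) (w t) ε) T ω) ω ∂μ := by
  obtain ⟨ρ, hρ, hmin⟩ := hmin
  have hclose : ∀ᶠ ε in 𝓝[>] (0 : ℝ), ε * (2 * R) < ρ :=
    nhdsWithin_le_nhds
      (((continuous_mul_const (2 * R)).tendsto' 0 0 (zero_mul _)).eventually_lt_const hρ)
  filter_upwards [Ioc_mem_nhdsGT zero_lt_one, hclose] with ε hε hερ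
  refine hmin _ (hv.lineMap hw (Ioc_subset_Icc_self hε)) ?_ fun t =>
    (hv.norm_sub_lineMap_le hw hε.1.le t).trans hερ.le
  filter_upwards [hU, hvU, hwU] with t hUt hvt hwt
  exact hUt.lineMap_mem hvt hwt (Ioc_subset_Icc_self hε)

variable [IsFiniteMeasure μ]

theorem inner_gradient_variation_nonneg (hmin : IsUniformLocalMinimizer μ f g U ψ t₀ T R v)
    (hf : IsLipDyn f C) (hg : IsLipCost μ g k) (hT : t₀ ≤ T)
    (hU : ∀ᵐ t ∂volume.restrict (Icc t₀ T), Convex ℝ (U t))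
    (hv : IsBoundedControl R v) (hvU : ∀ᵐ t ∂volume.restrict (Icc t₀ T), v t ∈ U t)
    (hw : IsBoundedControl R w) (hwU : ∀ᵐ t ∂volume.restrict (Icc t₀ T), w t ∈ U t)
    (hψ : Measurable ψ) (hψ_memLp : MemLp ψ 2 μ)
    (hdf : ∀ᵐ ω ∂μ, ∀ᵐ t ∂volume.restrict (Icc t₀ T),
      DifferentiableAt ℝ (fun y => dyn f y (v t) ω) (traj f t₀ T ψ v t ω))
    (hdg : ∀ᵐ ω ∂μ, DifferentiableAt ℝ (fun y => g y ω) (traj f t₀ T ψ v T ω)) :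
    0 ≤ inner ℝ (toLpClass 2 μ fun ω => gradient (fun z => g z ω) (traj f t₀ T ψ v T ω))
      (toLpClass 2 μ (variation f t₀ T ψ v w T)) := by
  obtain ⟨L, -, hL⟩ := hf.exists_norm_traj_sub_le (n := n) hv.nonneg hT
  have hX := hf.memLp_traj hv hT hψ hψ_memLp T
  rw [inner_toLpClass _ (hf.memLp_variation hv hw hT hψ hψ_memLp T),
    integral_congr_ae ((coeFn_toLpClass (hg.memLp_gradient hX.1.aemeasurable)).mono
      fun ω hω => by rw [hω])]
  have hline : ∀ ε ∈ Ioc (0 : ℝ) 1, IsBoundedControl R fun t => AffineMap.lineMap (v t) (w t) ε :=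
    fun ε hε => hv.lineMap hw (Ioc_subset_Icc_self hε)
  have hsmall : ∀ᶠ ε in 𝓝[>] (0 : ℝ), ε ∈ Ioc (0 : ℝ) 1 := Ioc_mem_nhdsGT zero_lt_one
  refine ge_of_tendsto (hg.tendsto_inv_mul_integral_sub (h := fun ω => 2 * R * L * (1 + ‖ψ ω‖))
    (z := fun ε => traj f t₀ T ψ (fun t => AffineMap.lineMap (v t) (w t) ε) T)
    (hX.integrable one_le_two) ?_
    (((integrable_const 1).add (hψ_memLp.integrable one_le_two).norm).const_mul _) ?_
    (hdf.mono fun ω hω => hf.tendsto_variation hv hw hT hψ hω) hdg) ?_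
  · filter_upwards [hsmall] with ε hε
    exact (hf.memLp_traj (hline ε hε) hT hψ hψ_memLp T).integrable one_le_two
  · filter_upwards [hsmall] with ε hε
    refine Eventually.of_forall fun ω => ?_
    rw [norm_sub_rev]
    exact (hL ψ v _ _ hv (hline ε hε) (hv.norm_sub_lineMap_le hw hε.1.le) T ω).1.trans_eq (by ring)
  · filter_upwards [hsmall, hmin.eventually_integral_le hU hv hvU hw hwU] with ε hε hle
    exact mul_nonneg (inv_nonneg.2 hε.1.le) (sub_nonneg.2 hle)

variable [IsSeparable μ] {p : ℝ → Lp (Vec n) 2 μ}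

theorem integral_inner_dynL2_sub_nonpos (hmin : IsUniformLocalMinimizer μ f g U ψ t₀ T R v)
    (hf : IsLipDyn f C) (hg : IsLipCost μ g k) (hT : t₀ ≤ T)
    (hU : ∀ᵐ t ∂volume.restrict (Icc t₀ T), Convex ℝ (U t))
    (hv : IsBoundedControl R v) (hvU : ∀ᵐ t ∂volume.restrict (Icc t₀ T), v t ∈ U t)
    (hw : IsBoundedControl R w) (hwU : ∀ᵐ t ∂volume.restrict (Icc t₀ T), w t ∈ U t)
    (hψ : Measurable ψ) (hψ_memLp : MemLp ψ 2 μ)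
    (hdf : ∀ᵐ ω ∂μ, ∀ᵐ t ∂volume.restrict (Icc t₀ T),
      DifferentiableAt ℝ (fun y => dyn f y (v t) ω) (traj f t₀ T ψ v t ω))
    (hdg : ∀ᵐ ω ∂μ, DifferentiableAt ℝ (fun y => g y ω) (traj f t₀ T ψ v T ω))
    (hp : HasW11Deriv t₀ T p fun t =>
      -(ContinuousLinearMap.adjoint (linOp μ f (traj f t₀ T ψ v t) (v t))) (p t))
    (hpT : -p T = toLpClass 2 μ fun ω => gradient (fun z => g z ω) (traj f t₀ T ψ v T ω)) :
    ∫ t in t₀..T, inner ℝ (p t)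
      (dynL2 μ f (traj f t₀ T ψ v t) (w t) - dynL2 μ f (traj f t₀ T ψ v t) (v t)) ≤ 0 := by
  have hvar := hmin.inner_gradient_variation_nonneg hf hg hT hU hv hvU hw hwU hψ hψ_memLp hdf hdg
  rw [← hpT, inner_neg_left] at hvar
  have hzero : MemLp (0 : Ω → Vec n) 2 μ := MemLp.zero
  have hleft : toLpClass 2 μ (variation f t₀ T ψ v w t₀) = 0 := by
    rw [hf.variation_left hv hw hT hψ, toLpClass_of_memLp hzero, MemLp.toLp_zero]
  rw [← hp.inner_sub_inner_of_adjoint hT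
    (hf.hasW11Deriv_toLpClass_variation hv hw hT hψ hψ_memLp), hleft, inner_zero_right, sub_zero]
  exact neg_nonneg.1 hvar

theorem ae_inner_dynL2_le (hmin : IsUniformLocalMinimizer μ f g U ψ t₀ T R v)
    (hf : IsLipDyn f C) (hg : IsLipCost μ g k) (hT : t₀ ≤ T)
    (hU : ∀ᵐ t ∂volume.restrict (Icc t₀ T), Convex ℝ (U t))
    (hU_graph : MeasurableSet
      {z : NullMeasurableSpace ℝ (volume : Measure ℝ) × Vec m | z.1 ∈ Icc t₀ T ∧ z.2 ∈ U z.1})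
    (hUR : ∀ t ∈ Icc t₀ T, ∀ c ∈ U t, ‖c‖ ≤ R)
    (hv : IsBoundedControl R v) (hvU : ∀ᵐ t ∂volume.restrict (Icc t₀ T), v t ∈ U t)
    (hψ : Measurable ψ) (hψ_memLp : MemLp ψ 2 μ)
    (hdf : ∀ᵐ ω ∂μ, ∀ᵐ t ∂volume.restrict (Icc t₀ T),
      DifferentiableAt ℝ (fun y => dyn f y (v t) ω) (traj f t₀ T ψ v t ω))
    (hdg : ∀ᵐ ω ∂μ, DifferentiableAt ℝ (fun y => g y ω) (traj f t₀ T ψ v T ω))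
    (hp_cont : Continuous p)
    (hp : HasW11Deriv t₀ T p fun t =>
      -(ContinuousLinearMap.adjoint (linOp μ f (traj f t₀ T ψ v t) (v t))) (p t))
    (hpT : -p T = toLpClass 2 μ fun ω => gradient (fun z => g z ω) (traj f t₀ T ψ v T ω)) :
    ∀ᵐ t ∂volume.restrict (Icc t₀ T), ∀ c ∈ U t,
      inner ℝ (p t) (dynL2 μ f (traj f t₀ T ψ v t) c) ≤
        inner ℝ (p t) (dynL2 μ f (traj f t₀ T ψ v t) (v t)) := by
  have hint : ∀ w, IsBoundedControl R w →
      Integrable (fun t => (inner ℝ (p t) (dynL2 μ f (traj f t₀ T ψ v t) (w t)) : ℝ))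
        (volume.restrict (Icc t₀ T)) := fun w hw =>
    hf.integrable_inner_dynL2 hT hv hw hψ hψ_memLp hp_cont
  refine ae_forall_le_of_forall_isBoundedControl
    (hf.measurable_inner_dynL2 hT hv hψ hψ_memLp hp_cont) hU_graph hUR hv hvU hint
    fun w hw hwU => ?_
  have hle := hmin.integral_inner_dynL2_sub_nonpos hf hg hT hU hv hvU hw hwU hψ hψ_memLp hdf hdg
    hp hpT
  simp only [inner_sub_right] at hle
  rwa [intervalIntegral.integral_of_le hT, ← integral_Icc_eq_integral_Ioc,
    integral_sub (hint w hw) (hint v hv), sub_nonpos] at hle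

end IsUniformLocalMinimizer

end MaximumPrinciple

/-! ### The maximum principle for `W^{1,1}`-local minimizers -/

section Processes

open scoped NNReal

variable {Ω : Type*} [MeasurableSpace Ω] {μ : Measure Ω} {n m : ℕ}
  {f : Fin (m + 1) → Vec n → Ω → Vec n} {g : Vec n → Ω → ℝ} {U : ℝ → Set (Vec m)}
  {C R t₀ T : ℝ} {k : ℝ≥0} {φ : Ω → Vec n} {u : ℝ → Vec m} {x : ℝ → Ω → Vec n}

theorem H1.ae_differentiableAt_dyn {Ω : Type*} [PseudoMetricSpace Ω] [MeasurableSpace Ω]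
    {μ : Measure Ω} {f : Fin (m + 1) → Vec n → Ω → Vec n} {g : Vec n → Ω → ℝ} {φ : Ω → Vec n}
    {x : ℝ → Ω → Vec n} {δ : ℝ} (h1 : H1 μ f g U t₀ T x δ) (hδ : 0 < δ)
    (hx : IsAdmissible f U φ t₀ T u x) (ω : Ω) : ∀ᵐ t ∂volume.restrict (Icc t₀ T),
      DifferentiableAt ℝ (fun y => dyn f y (u t) ω) (x t ω) := by
  filter_upwards [h1.f_contDiff ω, hx.control_mem] with t hcontDiff hut
  exact ((hcontDiff (u t) hut).contDiffAt (Metric.ball_mem_nhds _ hδ)).differentiableAt one_ne_zero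

namespace IsLipDyn

theorem exists_traj_ae_eq (hf : IsLipDyn f C) (hT : t₀ ≤ T) (hφ : MemLp φ 2 μ)
    (hx : IsAdmissible f U φ t₀ T u x) (hR : 0 ≤ R)
    (huR : ∀ᵐ t ∂volume.restrict (Icc t₀ T), ‖u t‖ ≤ R) :
    ∃ ψ v, Measurable ψ ∧ MemLp ψ 2 μ ∧ φ =ᵐ[μ] ψ ∧
      IsBoundedControl R v ∧ (∀ᵐ t ∂volume.restrict (Icc t₀ T), u t = v t) ∧
      ∀ᵐ ω ∂μ, ∀ t ∈ Icc t₀ T, x t ω = traj f t₀ T ψ v t ω := by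
  obtain ⟨v, hv, huv⟩ := exists_isBoundedControl hR hx.control_memLp.1 huR
  refine ⟨hφ.1.mk φ, v, hφ.1.stronglyMeasurable_mk.measurable,
    (memLp_congr_ae hφ.1.ae_eq_mk).1 hφ, hφ.1.ae_eq_mk, hv, huv, ?_⟩
  filter_upwards [hφ.1.ae_eq_mk] with ω hω t ht
  rw [← hf.traj_eq hv hT hx huv ht, traj, traj, hω]

variable [IsFiniteMeasure μ]

theorem memLp_of_isAdmissible (hf : IsLipDyn f C) (hT : t₀ ≤ T) (hφ : MemLp φ 2 μ)
    (hx : IsAdmissible f U φ t₀ T u x) (hR : 0 ≤ R)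
    (huR : ∀ᵐ t ∂volume.restrict (Icc t₀ T), ‖u t‖ ≤ R) {t : ℝ} (ht : t ∈ Icc t₀ T) :
    MemLp (x t) 2 μ := by
  obtain ⟨ψ, v, hψ, hψ_memLp, -, hv, -, hxX⟩ := hf.exists_traj_ae_eq hT hφ hx hR huR
  exact (memLp_congr_ae (hxX.mono fun ω hω => hω t ht)).2 (hf.memLp_traj hv hT hψ hψ_memLp t)

theorem exists_isEvolutionOperator_linOp [IsSeparable μ] (hf : IsLipDyn f C) (hT : t₀ ≤ T)
    (hφ : MemLp φ 2 μ) (hx : IsAdmissible f U φ t₀ T u x) (hR : 0 ≤ R)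
    (huR : ∀ᵐ t ∂volume.restrict (Icc t₀ T), ‖u t‖ ≤ R) :
    ∃ G, IsEvolutionOperator (fun s => linOp μ f (x s) (u s)) t₀ T G := by
  obtain ⟨ψ, v, hψ, -, -, hv, huv, hxX⟩ := hf.exists_traj_ae_eq hT hφ hx hR huR
  refine ⟨_, ((hf.isCaratheodory_linOp hv
    (hf.measurable_traj hv hT hψ)).isEvolutionOperator_flow t₀ T).congr ?_⟩
  filter_upwards [huv, ae_restrict_mem measurableSet_Icc] with t hut ht
  rw [linOp_congr f (hxX.mono fun ω hω => hω t ht), hut]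

end IsLipDyn

theorem IsW11LocalMinimizer.exists_costate [IsFiniteMeasure μ] [IsSeparable μ]
    (hmin : IsW11LocalMinimizer μ f g U φ t₀ T u x)
    (hf : IsLipDyn f C) (hg : IsLipCost μ g k) (hT : t₀ ≤ T) (hφ : MemLp φ 2 μ)
    (hU : ∀ᵐ t ∂volume.restrict (Icc t₀ T), Convex ℝ (U t))
    (hU_graph : MeasurableSet
      {z : NullMeasurableSpace ℝ (volume : Measure ℝ) × Vec m | z.1 ∈ Icc t₀ T ∧ z.2 ∈ U z.1})
    (hR : 0 ≤ R) (hUR : ∀ t ∈ Icc t₀ T, ∀ c ∈ U t, ‖c‖ ≤ R)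
    (hdf : ∀ᵐ ω ∂μ, ∀ᵐ t ∂volume.restrict (Icc t₀ T),
      DifferentiableAt ℝ (fun y => dyn f y (u t) ω) (x t ω))
    (hdg : ∀ᵐ ω ∂μ, DifferentiableAt ℝ (fun y => g y ω) (x T ω)) :
    ∃ p : ℝ → Lp (Vec n) 2 μ,
      HasW11Deriv t₀ T p
        (fun t => -(ContinuousLinearMap.adjoint (linOp μ f (x t) (u t))) (p t)) ∧
      -p T = toLpClass 2 μ (fun ω => gradient (fun z => g z ω) (x T ω)) ∧
      ∀ᵐ t ∂volume.restrict (Icc t₀ T),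
        IsGreatest ((fun c : Vec m => inner ℝ (p t) (dynL2 μ f (x t) c)) '' U t)
          (inner ℝ (p t) (dynL2 μ f (x t) (u t))) := by
  have hx := hmin.1
  have huR : ∀ᵐ t ∂volume.restrict (Icc t₀ T), ‖u t‖ ≤ R := by
    filter_upwards [hx.control_mem, ae_restrict_mem measurableSet_Icc] with t hut ht
    exact hUR t ht _ hut
  obtain ⟨ψ, v, hψ, hψ_memLp, hφψ, hv, huv, hxX⟩ := hf.exists_traj_ae_eq hT hφ hx hR huR
  have hxX_ae : ∀ t ∈ Icc t₀ T, x t =ᵐ[μ] traj f t₀ T ψ v t := fun t ht =>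
    hxX.mono fun ω hω => hω t ht
  have hT_mem : T ∈ Icc t₀ T := right_mem_Icc.2 hT
  have hvU : ∀ᵐ t ∂volume.restrict (Icc t₀ T), v t ∈ U t := by
    filter_upwards [hx.control_mem, huv] with t hut huvt using huvt ▸ hut
  have hdX : ∀ᵐ ω ∂μ, ∀ᵐ t ∂volume.restrict (Icc t₀ T),
      DifferentiableAt ℝ (fun y => dyn f y (v t) ω) (traj f t₀ T ψ v t ω) := by
    filter_upwards [hdf, hxX] with ω hω hxω
    filter_upwards [hω, huv, ae_restrict_mem measurableSet_Icc] with t hdiff hut ht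
    rwa [← hxω t ht, ← hut]
  obtain ⟨p, hp_cont, hp, hpT⟩ := (hf.isCaratheodory_linOp hv
    (hf.measurable_traj hv hT hψ)).exists_backward_solution hT
      (-toLpClass 2 μ fun ω => gradient (fun z => g z ω) (traj f t₀ T ψ v T ω))
  rw [← neg_eq_iff_eq_neg] at hpT
  have hmax := (hmin.isUniformLocalMinimizer hf hT hv huv hφψ hψ hψ_memLp).ae_inner_dynL2_le hf hg
    hT hU hU_graph hUR hv hvU hψ hψ_memLp hdX
    (by filter_upwards [hdg, hxX_ae T hT_mem] with ω hω hxω using hxω ▸ hω) hp_cont hp hpT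
  refine ⟨p, hp.congr hT (fun _ _ => rfl) ?_, hpT.trans (toLpClass_congr ?_), ?_⟩
  · filter_upwards [huv, ae_restrict_mem measurableSet_Icc] with t hut ht
    rw [linOp_congr f (hxX_ae t ht), hut]
  · exact (hxX_ae T hT_mem).mono fun ω hω => by simp only [hω]
  · filter_upwards [hmax, huv, hx.control_mem, ae_restrict_mem measurableSet_Icc]
      with t hmax_t huv_t hut ht
    simp only [dynL2_congr f (hxX_ae t ht)]
    exact ⟨mem_image_of_mem _ hut, forall_mem_image.2 fun c hc => huv_t ▸ hmax_t c hc⟩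

end Processes

end EnsemblePMP

open EnsemblePMP in
theorem mainTheorem1_general {Ω : Type*} [MeasurableSpace Ω] {μ : Measure Ω}
    [IsFiniteMeasure μ] [IsSeparable μ] {n m : ℕ} {t₀ T : ℝ}
    (hT : t₀ ≤ T) {f : Fin (m + 1) → Vec n → Ω → Vec n} {C : ℝ} (hf : IsLipDyn f C)
    {g : Vec n → Ω → ℝ} {k : NNReal} (hg : IsLipCost μ g k) {U : ℝ → Set (Vec m)}
    {K : Set (Vec m)} (hK : Bornology.IsBounded K) (hUK : ∀ t ∈ Icc t₀ T, U t ⊆ K)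
    (hU : ∀ᵐ t ∂volume.restrict (Icc t₀ T), Convex ℝ (U t))
    (hU_graph : MeasurableSet
      {z : NullMeasurableSpace ℝ volume × Vec m |
        z.1 ∈ Icc t₀ T ∧ z.2 ∈ U z.1})
    {φ : Ω → Vec n} (hφ : MemLp φ 2 μ) {u : ℝ → Vec m} {x : ℝ → Ω → Vec n}
    (hmin : IsW11LocalMinimizer μ f g U φ t₀ T u x)
    (hdf : ∀ᵐ ω ∂μ, ∀ᵐ t ∂volume.restrict (Icc t₀ T),
      DifferentiableAt ℝ (fun y => dyn f y (u t) ω) (x t ω))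
    (hdg : ∀ᵐ ω ∂μ, DifferentiableAt ℝ (fun y => g y ω) (x T ω)) :
    (∀ t ∈ Icc t₀ T, MemLp (x t) 2 μ ∧
      (∀ v : Vec m, MemLp (fun ω => dyn f (x t ω) v ω) 2 μ) ∧
      MemLp (fun ω => dynJac f (x t ω) (u t) ω) ⊤ μ) ∧
    MemLp (fun ω => gradient (fun z => g z ω) (x T ω)) 2 μ ∧
    (∃ G, IsEvolutionOperator (fun s => linOp μ f (x s) (u s)) t₀ T G) ∧
    ∀ G, IsEvolutionOperator (fun s => linOp μ f (x s) (u s)) t₀ T G →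
      ∀ q : Lp (Vec n) 2 μ,
        q = toLpClass 2 μ (fun ω => gradient (fun z => g z ω) (x T ω)) →
      ∀ p : ℝ → Lp (Vec n) 2 μ,
        (∀ t ∈ Icc t₀ T, p t = -(ContinuousLinearMap.adjoint (G T t)) q) →
        HasW11Deriv t₀ T p
          (fun t => -(ContinuousLinearMap.adjoint (linOp μ f (x t) (u t))) (p t)) ∧
        -p T = q ∧
        (∀ p' : ℝ → Lp (Vec n) 2 μ,
          HasW11Deriv t₀ T p'
            (fun t => -(ContinuousLinearMap.adjoint (linOp μ f (x t) (u t))) (p' t)) →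
          -p' T = q → EqOn p' p (Icc t₀ T)) ∧
        ∀ᵐ t ∂volume.restrict (Icc t₀ T),
          IsGreatest ((fun v : Vec m => inner ℝ (p t) (dynL2 μ f (x t) v)) '' U t)
            (inner ℝ (p t) (dynL2 μ f (x t) (u t))) := by
  obtain ⟨R, hR, hKR⟩ := hK.exists_pos_norm_le
  have hUR : ∀ t ∈ Icc t₀ T, ∀ c ∈ U t, ‖c‖ ≤ R := fun t ht c hc => hKR c (hUK t ht hc)
  have huR : ∀ᵐ t ∂volume.restrict (Icc t₀ T), ‖u t‖ ≤ R := by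
    filter_upwards [hmin.1.control_mem, ae_restrict_mem measurableSet_Icc] with t hut ht
    exact hUR t ht _ hut
  have hT_mem : T ∈ Icc t₀ T := right_mem_Icc.2 hT
  have hx : ∀ t ∈ Icc t₀ T, MemLp (x t) 2 μ := fun t =>
    hf.memLp_of_isAdmissible hT hφ hmin.1 hR.le huR
  refine ⟨fun t ht => ⟨hx t ht, hf.memLp_dyn (hx t ht),
      hf.memLp_dynJac (hx t ht).1.aemeasurable _⟩,
    hg.memLp_gradient (hx T hT_mem).1.aemeasurable,
    hf.exists_isEvolutionOperator_linOp hT hφ hmin.1 hR.le huR, fun G hG q hq p hp => ?_⟩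
  have hsolution : ∀ p', HasW11Deriv t₀ T p'
      (fun t => -(ContinuousLinearMap.adjoint (linOp μ f (x t) (u t))) (p' t)) →
      -p' T = q → EqOn p' p (Icc t₀ T) := fun p' hp' hp'T t ht => by
    rw [hp t ht, ← hp'T, map_neg, neg_neg, hG.eq_adjoint_apply hp' ht]
  obtain ⟨p', hp', hp'T, hmax⟩ :=
    hmin.exists_costate hf hg hT hφ hU hU_graph hR.le hUR hdf hdg
  have heq := hsolution p' hp' (hp'T.trans hq.symm)
  have hae : ∀ᵐ t ∂volume.restrict (Icc t₀ T), p' t = p t :=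
    (ae_restrict_mem measurableSet_Icc).mono heq
  refine ⟨hp'.congr hT heq.symm (hae.mono fun t ht => by rw [ht]),
    by rw [← heq hT_mem, hp'T, hq], hsolution, ?_⟩
  filter_upwards [hmax, hae] with t hmax_t ht using ht ▸ hmax_t

open EnsemblePMP in
theorem mainTheorem1 {Ω : Type*} [MetricSpace Ω] [CompleteSpace Ω]
    [TopologicalSpace.SeparableSpace Ω] [MeasurableSpace Ω] [BorelSpace Ω]
    (μ : MeasureTheory.Measure Ω) [MeasureTheory.IsProbabilityMeasure μ]
    {n m : ℕ} (t₀ T : ℝ) (ht : t₀ < T)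
    (f : Fin (m + 1) → Vec n → Ω → Vec n) (g : Vec n → Ω → ℝ) (U : ℝ → Set (Vec m))
    (φ : Ω → Vec n) (hφ : MeasureTheory.MemLp φ 2 μ)
    (u : ℝ → Vec m) (x : ℝ → Ω → Vec n) (δ : ℝ) (hδ : 0 < δ)
    (h0 : H0 f g U t₀ T)
    (hmin : IsW11LocalMinimizer μ f g U φ t₀ T u x)
    (h1 : H1 μ f g U t₀ T x δ) :
    -- all the objects of the statement are well defined
    (∀ t ∈ Set.Icc t₀ T, MeasureTheory.MemLp (x t) 2 μ ∧
      (∀ v : Vec m, MeasureTheory.MemLp (fun ω => dyn f (x t ω) v ω) 2 μ) ∧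
      MeasureTheory.MemLp (fun ω => dynJac f (x t ω) (u t) ω) ⊤ μ) ∧
    MeasureTheory.MemLp (fun ω => gradient (fun z => g z ω) (x T ω)) 2 μ ∧
    (∃ G, IsEvolutionOperator (fun s => linOp μ f (x s) (u s)) t₀ T G) ∧
    -- the maximum principle
    ∀ G, IsEvolutionOperator (fun s => linOp μ f (x s) (u s)) t₀ T G →
      ∀ q : MeasureTheory.Lp (Vec n) 2 μ,
        q = toLpClass 2 μ (fun ω => gradient (fun z => g z ω) (x T ω)) →
      ∀ p : ℝ → MeasureTheory.Lp (Vec n) 2 μ,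
        (∀ t ∈ Set.Icc t₀ T, p t = -(ContinuousLinearMap.adjoint (G T t)) q) →
        -- `p ∈ W^{1,1}` is the solution of the backward problem
        HasW11Deriv t₀ T p
          (fun t => -(ContinuousLinearMap.adjoint (linOp μ f (x t) (u t))) (p t)) ∧
        -p T = q ∧
        (∀ p' : ℝ → MeasureTheory.Lp (Vec n) 2 μ,
          HasW11Deriv t₀ T p'
            (fun t => -(ContinuousLinearMap.adjoint (linOp μ f (x t) (u t))) (p' t)) →
          -p' T = q → Set.EqOn p' p (Set.Icc t₀ T)) ∧
        -- the maximum condition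
        ∀ᵐ t ∂(MeasureTheory.volume.restrict (Set.Icc t₀ T)),
          IsGreatest ((fun v : Vec m => inner ℝ (p t) (dynL2 μ f (x t) v)) '' U t)
            (inner ℝ (p t) (dynL2 μ f (x t) (u t))) := by
  obtain ⟨C, hf⟩ := h0.exists_isLipDyn
  obtain ⟨k, hg⟩ := h0.exists_isLipCost (μ := μ)
  obtain ⟨K, hK, hUK⟩ := h0.U_bounded
  exact mainTheorem1_general ht.le hf hg hK.isBounded hUK h0.U_convex h0.U_graph hφ hmin
    (.of_forall (h1.ae_differentiableAt_dyn hδ hmin.1))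
    (.of_forall fun ω => h1.g_diff ω _ (Metric.mem_ball_self hδ))
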